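/- Setting. Let $P$ be a probability distribution on a measurable space $\mathcal X$, let $\psi$ be a real functional on the probability distributions on $\mathcal X$, and write $\psi=\psi(P)$ for the target. For any input distribution $Q$ one can only observe independent computation runs $\hat\psi_1(Q),\hat\psi_2(Q),\ldots$, where $\hat\psi_r(Q)=\hat\psi(Q,\xi_r)$ with i.i.d. computation noises $\xi_r$ (of a law that does not depend on $Q$), and $E\hat\psi_r(Q)=\psi(Q)$. Let $\tau^2(Q)=\mathrm{Var}(\hat\psi_r(Q))$ and $\kappa_3(Q)=E|\hat\psi_r(Q)-\psi(Q)|^3$. Let $X_1,\ldots,X_n$ be i.i.d. from $P$ with empirical distribution $\hat P_n$, and let $P_n^{*1},\ldots,P_n^{*B}$ be the empirical distributions of $B$ resamples of size $n$, each drawn independently and uniformly with replacement from the data ($P_n^*$ denotes any one of them). Put $$\hat{\hat\psi}_{n,R_0}=\frac1{R_0}\sum_{r=1}^{R_0}\hat\psi_r(\hat P_n),\qquad \psi_{n,R}^{**b}=\frac1R\sum_{r=1}^{R}\hat\psi_r(P_n^{*b}),\quad b=1,\ldots,B,$$ where all $R_0+BR$ runs use independent computation noises, independent of the data and the resampling.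 Assumptions. (i) For some $\sigma>0$, $\sqrt n(\psi(\hat P_n)-\psi)\Rightarrow N(0,\sigma^2)$, and $\sqrt n(\psi(P_n^*)-\psi(\hat P_n))\Rightarrow N(0,\sigma^2)$ conditionally on the data in probability, i.e. for every $x\in\mathbb R$ the conditional probability of $\{\sqrt n(\psi(P_n^*)-\psi(\hat P_n))\le x\}$ given the data converges in probability to $P(N(0,\sigma^2)\le x)$. (ii) $0<\tau^2(P)<\infty$, $\kappa_3(P)<\infty$, and, as $n\to\infty$, $\tau^2(\hat P_n)\to\tau^2(P)$, $\kappa_3(\hat P_n)\to\kappa_3(P)$, $\tau^2(P_n^*)\to\tau^2(P)$ and $\kappa_3(P_n^*)\to\kappa_3(P)$ in probability. (iii) $R_0=R_0(n)$ and $R=R(n)$ satisfy $R_0/n\to p_0$ and $R/n\to p$ as $n\to\infty$, for some constants $0<p_0,p<1$. Interval. Let $B\ge1$ and $0<\alpha<1$ be fixed, let $\rho=\sqrt{p_0/p}$, and for $\theta\ge0$ let $F(\cdot\,;\theta,\rho)$ be the distribution function of $$\frac{\theta V_1+V_2}{\sqrt{\frac{\theta^2+\rho^2}{B}(Y+V_3^2)-2\sqrt{\frac{\theta^2+\rho^2}{B}}\,V_3V_2+V_2^2}},$$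 where $V_1,V_2,V_3\sim N(0,1)$ and $Y\sim\chi^2_{B-1}$ are independent ($Y=0$ if $B=1$). Let $$S_O^2=\frac1B\sum_{b=1}^B\bigl(\psi_{n,R}^{**b}-\hat{\hat\psi}_{n,R_0}\bigr)^2,\qquad q_{O,1-\alpha/2}=\min\Bigl\{q\in\mathbb R:\ \inf_{\theta\ge0}F(q;\theta,\rho)\ge1-\frac\alpha2\Bigr\},$$ $$\mathcal I_O=\bigl[\hat{\hat\psi}_{n,R_0}-q_{O,1-\alpha/2}S_O,\ \hat{\hat\psi}_{n,R_0}+q_{O,1-\alpha/2}S_O\bigr],\qquad S_O\ge 0.$$ Theorem (Asymptotic validity of the Cheap Bootstrap "centered at original estimate"). The minimum that defines $q_{O,1-\alpha/2}$ exists, and $$\liminf_{n\to\infty}\mathbb P_n(\psi\in\mathcal I_O)\ge1-\alpha,$$ where $\mathbb P_n$ denotes the probability with respect to the data $X_1,\ldots,X_n$ and all randomness from the resampling and computation. -/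

import Mathlib

open MeasureTheory ProbabilityTheory Filter Topology
open scoped NNReal ENNReal

namespace CheapBootstrap

noncomputable section

/-! ### Data, resampling and computation runs -/

/-- The empirical distribution `(1/n) ∑ᵢ δ_{xᵢ}` of a sample of size `n ≥ 1`. -/
def empirical {𝒳 : Type*} [MeasurableSpace 𝒳] {n : ℕ+} (x : Fin n → 𝒳) :
    ProbabilityMeasure 𝒳 :=
  ⟨(n : ℝ≥0∞)⁻¹ • ∑ i, Measure.dirac (x i), ⟨by
    rw [Measure.smul_apply, Measure.finsetSum_apply]
    simp only [measure_univ, Finset.sum_const, Finset.card_univ, Fintype.card_fin, nsmul_eq_mul,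
      mul_one, smul_eq_mul]
    exact ENNReal.inv_mul_cancel (by simp) (by simp)⟩⟩

/-- The law of the i.i.d. data `X₁, …, Xₙ ∼ P`. -/
def dataLaw {𝒳 : Type*} [MeasurableSpace 𝒳] (P : ProbabilityMeasure 𝒳) (n : ℕ+) :
    Measure (Fin n → 𝒳) :=
  Measure.pi fun _ => (P : Measure 𝒳)

instance {𝒳 : Type*} [MeasurableSpace 𝒳] (P : ProbabilityMeasure 𝒳) (n : ℕ+) :
    IsProbabilityMeasure (dataLaw P n) := by
  unfold dataLaw; infer_instance

/-- The law of the `n` indices of one resample: independent and uniform on the `n` data points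
(sampling with replacement). -/
def resampleLaw (n : ℕ+) : Measure (Fin n → Fin n) :=
  Measure.pi fun _ => uniformOn Set.univ

/-- The empirical distribution of the resample of the data `x` that has the indices `I`. -/
def resampled {𝒳 : Type*} [MeasurableSpace 𝒳] {n : ℕ+} (x : Fin n → 𝒳) (I : Fin n → Fin n) :
    ProbabilityMeasure 𝒳 :=
  empirical (x ∘ I)

/-- `τ²(Q)`, the variance of a single computation run driven by the input distribution `Q`. A run
driven by `Q` is `run Q ξ`, where the computation noise `ξ` has law `η`. -/
def runVar {𝒳 𝒰 : Type*} [MeasurableSpace 𝒳] [MeasurableSpace 𝒰]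
    (run : ProbabilityMeasure 𝒳 → 𝒰 → ℝ) (η : Measure 𝒰) (Q : ProbabilityMeasure 𝒳) : ℝ≥0∞ :=
  evariance (run Q) η

/-- `κ₃(Q) = E|ψ̂(Q) - ψ(Q)|³`, the third absolute central moment of a single run. -/
def runThirdMoment {𝒳 𝒰 : Type*} [MeasurableSpace 𝒳] [MeasurableSpace 𝒰]
    (ψ : ProbabilityMeasure 𝒳 → ℝ) (run : ProbabilityMeasure 𝒳 → 𝒰 → ℝ) (η : Measure 𝒰)
    (Q : ProbabilityMeasure 𝒳) : ℝ≥0∞ :=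
  ∫⁻ u, ENNReal.ofReal (|run Q u - ψ Q| ^ 3) ∂η

/-- The average of `R` runs driven by `Q`, with computation noises `ξ₁, …, ξ_R`. -/
def runMean {𝒳 𝒰 : Type*} [MeasurableSpace 𝒳] (run : ProbabilityMeasure 𝒳 → 𝒰 → ℝ)
    (Q : ProbabilityMeasure 𝒳) {R : ℕ} (ξ : Fin R → 𝒰) : ℝ :=
  (∑ r, run Q (ξ r)) / R

/-! ### The sample space of the whole procedure -/

/-- An outcome of the nested procedure: the data, the indices of the `B` resamples, the noises of
the `R₀` runs for the original estimate, and the noises of the `R` runs for each resample. -/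
abbrev Outcome (𝒳 𝒰 : Type*) (n : ℕ+) (B R₀ R : ℕ) : Type _ :=
  (Fin n → 𝒳) × (Fin B → Fin n → Fin n) × (Fin R₀ → 𝒰) × (Fin B → Fin R → 𝒰)

/-- The probability `ℙₙ` with respect to the data and all randomness from the resampling and the
computation. -/
def outcomeLaw {𝒳 𝒰 : Type*} [MeasurableSpace 𝒳] [MeasurableSpace 𝒰] (P : ProbabilityMeasure 𝒳)
    (η : Measure 𝒰) (n : ℕ+) (B R₀ R : ℕ) : Measure (Outcome 𝒳 𝒰 n B R₀ R) :=
  (dataLaw P n).prod ((Measure.pi fun _ => resampleLaw n).prod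
    ((Measure.pi fun _ => η).prod (Measure.pi fun _ => Measure.pi fun _ => η)))

section Estimators

variable {𝒳 𝒰 : Type*} [MeasurableSpace 𝒳] (run : ProbabilityMeasure 𝒳 → 𝒰 → ℝ)
  {n : ℕ+} {B R₀ R : ℕ} (ω : Outcome 𝒳 𝒰 n B R₀ R)

/-- The original (point) estimate: the average of `R₀` runs driven by the empirical
distribution of the data. -/
def pointEst : ℝ := runMean run (empirical ω.1) ω.2.2.1

/-- The `b`-th resample estimate: the average of `R` runs driven by the `b`-th resample
empirical distribution. -/
def resampleEst (b : Fin B) : ℝ := runMean run (resampled ω.1 (ω.2.1 b)) (ω.2.2.2 b)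

/-- `S_O`, where `S_O² = (1/B) ∑_b (resample estimate_b - original estimate)²`. -/
def SO : ℝ := √((∑ b, (resampleEst run ω b - pointEst run ω) ^ 2) / B)

end Estimators

/-! ### The critical value -/

/-- The chi-square distribution with `k` degrees of freedom, the law of the sum of the squares of
`k` independent standard normal variables (the point mass at `0` if `k = 0`). -/
def chiSq (k : ℕ) : Measure ℝ :=
  (Measure.pi fun _ : Fin k => gaussianReal 0 1).map fun z => ∑ i, z i ^ 2

/-- The law of
`(θV₁ + V₂) / √((θ² + ρ²)/B (Y + V₃²) - 2 √((θ² + ρ²)/B) V₃ V₂ + V₂²)`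
for independent `V₁, V₂, V₃ ∼ N(0,1)` and `Y ∼ χ²_{B-1}`. -/
def ratioLaw (B : ℕ) (θ ρ : ℝ) : Measure ℝ :=
  ((gaussianReal 0 1).prod ((gaussianReal 0 1).prod
    ((gaussianReal 0 1).prod (chiSq (B - 1))))).map
    fun v : ℝ × ℝ × ℝ × ℝ =>
      (θ * v.1 + v.2.1) /
        √((θ ^ 2 + ρ ^ 2) / B * (v.2.2.2 + v.2.2.1 ^ 2)
          - 2 * √((θ ^ 2 + ρ ^ 2) / B) * v.2.2.1 * v.2.1 + v.2.1 ^ 2)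

/-- `F(q; θ, ρ)`, the distribution function of `ratioLaw`. -/
def F (B : ℕ) (q θ ρ : ℝ) : ℝ := cdf (ratioLaw B θ ρ) q

/-- The set of all `q` with `inf_{θ ≥ 0} F(q; θ, ρ) ≥ 1 - α/2`. -/
def criticalSet (B : ℕ) (ρ α : ℝ) : Set ℝ :=
  {q | 1 - α / 2 ≤ ⨅ θ : ℝ≥0, F B q θ ρ}

/-- The critical value `q_{O,1-α/2}`, the least element of `criticalSet`. -/
def qO (B : ℕ) (ρ α : ℝ) : ℝ := sInf (criticalSet B ρ α)

/-- The interval `[original estimate - q S_O, original estimate + q S_O]`. -/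
def intervalO {𝒳 𝒰 : Type*} [MeasurableSpace 𝒳] (run : ProbabilityMeasure 𝒳 → 𝒰 → ℝ)
    {n : ℕ+} {B R₀ R : ℕ} (q : ℝ) (ω : Outcome 𝒳 𝒰 n B R₀ R) : Set ℝ :=
  Set.Icc (pointEst run ω - q * SO run ω) (pointEst run ω + q * SO run ω)

/-! ### The assumptions -/

/-- Convergence in probability to a constant `c`, for random elements `X n` that may live on
different probability spaces: `X n` leaves each neighbourhood of `c` with vanishing probability. -/
def TendstoInProb {Ω : ℕ+ → Type*} [∀ n, MeasurableSpace (Ω n)] {E : Type*} [TopologicalSpace E]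
    (μ : ∀ n, Measure (Ω n)) (X : ∀ n, Ω n → E) (c : E) : Prop :=
  ∀ s ∈ 𝓝 c, Tendsto (fun n => μ n {ω | X n ω ∉ s}) atTop (𝓝 0)

/-- The standard condition for bootstrap validity: `√n (ψ(P̂ₙ) - ψ(P)) ⇒ N(0, σ²)`, and
`√n (ψ(Pₙ*) - ψ(P̂ₙ)) ⇒ N(0, σ²)` conditionally on the data in probability, which means that the
conditional distribution function converges in probability at every point. -/
structure BootstrapValidity {𝒳 : Type*} [MeasurableSpace 𝒳] (ψ : ProbabilityMeasure 𝒳 → ℝ)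
    (P : ProbabilityMeasure 𝒳) (σ : ℝ≥0) : Prop where
  pos : 0 < σ
  original : TendstoInDistribution
    (fun (n : ℕ+) (x : Fin n → 𝒳) => √(n : ℝ) * (ψ (empirical x) - ψ P)) atTop
    (id : ℝ → ℝ) (dataLaw P) (gaussianReal 0 (σ ^ 2))
  resample : ∀ t : ℝ, TendstoInProb (dataLaw P)
    (fun n x => (resampleLaw n).real
      {I | √(n : ℝ) * (ψ (resampled x I) - ψ (empirical x)) ≤ t})
    (cdf (gaussianReal 0 (σ ^ 2)) t)

/-- Moment consistency of computation runs: `τ²` and `κ₃` at `P̂ₙ` and at `Pₙ*` converge in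
probability to their values at `P`, with `0 < τ²(P) < ∞` and `κ₃(P) < ∞`. -/
structure MomentConsistency {𝒳 𝒰 : Type*} [MeasurableSpace 𝒳] [MeasurableSpace 𝒰]
    (ψ : ProbabilityMeasure 𝒳 → ℝ) (run : ProbabilityMeasure 𝒳 → 𝒰 → ℝ) (η : Measure 𝒰)
    (P : ProbabilityMeasure 𝒳) : Prop where
  var_pos : 0 < runVar run η P
  var_lt_top : runVar run η P < ∞
  third_lt_top : runThirdMoment ψ run η P < ∞
  var_original : TendstoInProb (dataLaw P) (fun _ x => runVar run η (empirical x)) (runVar run η P)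
  third_original : TendstoInProb (dataLaw P)
    (fun _ x => runThirdMoment ψ run η (empirical x)) (runThirdMoment ψ run η P)
  var_resample : TendstoInProb (fun n => (dataLaw P n).prod (resampleLaw n))
    (fun _ z => runVar run η (resampled z.1 z.2)) (runVar run η P)
  third_resample : TendstoInProb (fun n => (dataLaw P n).prod (resampleLaw n))
    (fun _ z => runThirdMoment ψ run η (resampled z.1 z.2)) (runThirdMoment ψ run η P)

end

end CheapBootstrap

/- Given the input distributions, the averages of unbiased runs are asymptotically Gaussian with
variances `τ²/R₀` and `τ²/R`, because their third absolute moments converge. Integrating this first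
over the resampling given the data and then over the data shows that the errors
`√n (ψ(P̂ₙ) - ψ)`, `√n (original estimate - ψ(P̂ₙ))` and `√n (bootstrap estimate b - ψ(P̂ₙ))` have
independent Gaussian limits with variances `σ²`, `τ²/p₀` and `σ² + τ²/p`. Coverage contains an open,
scale-invariant condition on these errors; dividing by `τ/√p₀` turns its limiting probability into
that of `|ratio| < q` at `θ = σ √p₀ / τ`. The law of the ratio is symmetric and `q` is at least its
`1 - α/2` quantile for every `θ`, so this probability is at least `1 - α`. -/

namespace CheapBootstrap

section InProb

variable {ι : Type*} {Ω : ι → Type*} [∀ i, MeasurableSpace (Ω i)] {l : Filter ι}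
  {μ : ∀ i, Measure (Ω i)}

/-- Convergence in probability along `l` on the varying probability spaces `(Ω i, μ i)`, as a
filter on their disjoint union: a set is large if the probability of its complement tends to `0`.
It turns the calculus of convergence in probability into that of `Filter.Tendsto`. -/
def inProb (l : Filter ι) (μ : ∀ i, Measure (Ω i)) : Filter (Σ i, Ω i) where
  sets := {S | Tendsto (fun i => μ i {ω | ⟨i, ω⟩ ∉ S}) l (𝓝 0)}
  univ_sets := by simpa using tendsto_const_nhds
  sets_of_superset h hST :=
    tendsto_of_tendsto_of_tendsto_of_le_of_le tendsto_const_nhds h (fun _ => zero_le)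
      fun _ => measure_mono fun _ hω hS => hω (hST hS)
  inter_sets {S T} hS hT := by
    refine tendsto_of_tendsto_of_tendsto_of_le_of_le tendsto_const_nhds
      (by simpa using Tendsto.add hS hT) (fun _ => zero_le) fun i => ?_
    refine (measure_mono fun ω hω => ?_).trans (measure_union_le _ _)
    exact not_and_or.1 hω

lemma tendstoInProb_iff_tendsto {Ω : ℕ+ → Type*} [∀ n, MeasurableSpace (Ω n)] {E : Type*}
    [TopologicalSpace E] {μ : ∀ n, Measure (Ω n)} {X : ∀ n, Ω n → E} {c : E} :
    TendstoInProb μ X c ↔ Tendsto (fun z : Σ n, Ω n => X z.1 z.2) (inProb atTop μ) (𝓝 c) :=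
  Iff.rfl

lemma tendsto_fst_inProb : Tendsto Sigma.fst (inProb l μ) l := by
  intro S hS
  refine tendsto_const_nhds.congr' ?_
  filter_upwards [hS] with i hi
  simp [hi]

lemma tendsto_sigmaMap_inProb {Ω' : ι → Type*} [∀ i, MeasurableSpace (Ω' i)]
    {ν : ∀ i, Measure (Ω' i)} {f : ∀ i, Ω i → Ω' i}
    (hf : ∀ i, MeasurePreserving (f i) (μ i) (ν i)) :
    Tendsto (Sigma.map id f) (inProb l μ) (inProb l ν) := by
  intro S hS
  refine tendsto_of_tendsto_of_tendsto_of_le_of_le tendsto_const_nhds hS (fun _ => zero_le)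
    fun i => ?_
  rw [← (hf i).map_eq]
  exact Measure.le_map_apply (hf i).measurable.aemeasurable _

variable [∀ i, IsProbabilityMeasure (μ i)]

lemma tendsto_lintegral_enorm_sub_of_inProb {E : Type*} [SeminormedAddCommGroup E]
    {W : ∀ i, Ω i → E} {K : E} {C : ℝ} (hWC : ∀ i ω, ‖W i ω‖ ≤ C)
    (hW : Tendsto (fun z : Σ i, Ω i => W z.1 z.2) (inProb l μ) (𝓝 K)) :
    Tendsto (fun i => ∫⁻ ω, ‖W i ω - K‖ₑ ∂(μ i)) l (𝓝 0) := by
  rw [ENNReal.tendsto_nhds_zero]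
  intro ε hε
  have hε2 := ENNReal.half_pos hε.ne'
  let bad i := {ω | W i ω ∉ Metric.eball K (ε / 2)}
  have hbad : Tendsto (fun i => ENNReal.ofReal (C + ‖K‖) * μ i (bad i)) l
      (𝓝 (ENNReal.ofReal (C + ‖K‖) * 0)) :=
    ENNReal.Tendsto.const_mul (hW (Metric.eball_mem_nhds K hε2)) (Or.inr ENNReal.ofReal_ne_top)
  rw [mul_zero] at hbad
  filter_upwards [ENNReal.tendsto_nhds_zero.1 hbad (ε / 2) hε2] with i hi
  let T := toMeasurable (μ i) (bad i)
  have hpointwise ω : ‖W i ω - K‖ₑ ≤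
      ε / 2 + T.indicator (fun _ => ENNReal.ofReal (C + ‖K‖)) ω := by
    by_cases hω : ω ∈ T
    · rw [Set.indicator_of_mem hω, ← ofReal_norm]
      refine le_add_left (ENNReal.ofReal_le_ofReal ((norm_sub_le _ _).trans ?_))
      gcongr
      exact hWC i ω
    · have hgood : W i ω ∈ Metric.eball K (ε / 2) :=
        not_not.1 fun h => hω (subset_toMeasurable _ _ h)
      rw [Metric.mem_eball, edist_eq_enorm_sub] at hgood
      exact hgood.le.trans le_self_add
  calc ∫⁻ ω, ‖W i ω - K‖ₑ ∂(μ i)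
      ≤ ∫⁻ ω, (ε / 2 + T.indicator (fun _ => ENNReal.ofReal (C + ‖K‖)) ω) ∂(μ i) :=
        lintegral_mono hpointwise
    _ = ε / 2 + ENNReal.ofReal (C + ‖K‖) * μ i (bad i) := by
        rw [lintegral_add_left measurable_const,
          lintegral_indicator_const (measurableSet_toMeasurable _ _), measure_toMeasurable]
        simp
    _ ≤ ε / 2 + ε / 2 := by gcongr
    _ = ε := ENNReal.add_halves ε

lemma tendsto_integral_mul_of_inProb {𝕜 : Type*} [RCLike 𝕜] {Z W : ∀ i, Ω i → 𝕜}
    {a K : 𝕜} {C D : ℝ}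
    (hZm : ∀ i, AEStronglyMeasurable (Z i) (μ i)) (hWm : ∀ i, AEStronglyMeasurable (W i) (μ i))
    (hZC : ∀ i ω, ‖Z i ω‖ ≤ C) (hWD : ∀ i ω, ‖W i ω‖ ≤ D)
    (hZ : Tendsto (fun i => ∫ ω, Z i ω ∂(μ i)) l (𝓝 a))
    (hW : Tendsto (fun z : Σ i, Ω i => W z.1 z.2) (inProb l μ) (𝓝 K)) :
    Tendsto (fun i => ∫ ω, Z i ω * W i ω ∂(μ i)) l (𝓝 (a * K)) := by
  have hZint i : Integrable (Z i) (μ i) := .of_bound (hZm i) C (ae_of_all _ (hZC i))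
  have hWint i : Integrable (W i) (μ i) := .of_bound (hWm i) D (ae_of_all _ (hWD i))
  have hZWint i : Integrable (fun ω => Z i ω * W i ω) (μ i) :=
    (hWint i).bdd_mul (hZm i) (ae_of_all _ (hZC i))
  have hdiff : Tendsto (fun i => ∫ ω, Z i ω * (W i ω - K) ∂(μ i)) l (𝓝 0) := by
    rw [tendsto_zero_iff_enorm_tendsto_zero]
    refine tendsto_of_tendsto_of_tendsto_of_le_of_le tendsto_const_nhds ?_ (fun _ => zero_le)
      fun i => enorm_integral_le_lintegral_enorm _
    refine tendsto_of_tendsto_of_tendsto_of_le_of_le tendsto_const_nhds ?_ (fun _ => zero_le)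
      (h := fun i => ENNReal.ofReal C * ∫⁻ ω, ‖W i ω - K‖ₑ ∂(μ i)) fun i => ?_
    · simpa using ENNReal.Tendsto.const_mul (tendsto_lintegral_enorm_sub_of_inProb hWD hW)
        (Or.inr ENNReal.ofReal_ne_top)
    · dsimp only
      rw [← lintegral_const_mul' _ _ ENNReal.ofReal_ne_top]
      refine lintegral_mono fun ω => (enorm_mul _ _).trans_le ?_
      gcongr
      rw [← ofReal_norm]
      exact ENNReal.ofReal_le_ofReal (hZC i ω)
  have hsplit i : ∫ ω, Z i ω * W i ω ∂(μ i) =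
      ∫ ω, Z i ω * (W i ω - K) ∂(μ i) + (∫ ω, Z i ω ∂(μ i)) * K := by
    simp_rw [mul_sub]
    rw [integral_sub (hZWint i) ((hZint i).mul_const K), integral_mul_const,
      sub_add_cancel]
  simp_rw [hsplit]
  simpa using hdiff.add (hZ.mul_const K)

end InProb

section CharFun

variable {α : Type*} {l : Filter α}

lemma tendsto_probabilityMeasure_of_tendsto_cdf_rat [l.IsCountablyGenerated]
    {μ : α → ProbabilityMeasure ℝ} {ν : ProbabilityMeasure ℝ}
    (h : ∀ r : ℚ, Tendsto (fun i => cdf (μ i : Measure ℝ) r) l (𝓝 (cdf (ν : Measure ℝ) r))) :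
    Tendsto μ l (𝓝 ν) := by
  have measure_Ioc (ρ : ProbabilityMeasure ℝ) {a b : ℝ} (hab : a ≤ b) :
      ((ρ (Set.Ioc a b) : ℝ≥0) : ℝ) = cdf (ρ : Measure ℝ) b - cdf (ρ : Measure ℝ) a := by
    rw [cdf_eq_real, cdf_eq_real, ← measureReal_sdiff (Set.Iic_subset_Iic.2 hab) measurableSet_Iic,
      Set.Iic_sdiff_Iic]
    rfl
  refine IsPiSystem.tendsto_probabilityMeasure_of_tendsto_of_mem
    (S := {s | ∃ a b : ℚ, a ≤ b ∧ s = Set.Ioc (a : ℝ) b}) ?_ ?_ ?_ ?_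
  · rintro _ ⟨a, b, -, rfl⟩ _ ⟨c, d, -, rfl⟩ hne
    have hinter : Set.Ioc (a : ℝ) b ∩ Set.Ioc (c : ℝ) d =
        Set.Ioc ((max a c : ℚ) : ℝ) ((min b d : ℚ) : ℝ) := by
      rw [Set.Ioc_inter_Ioc, Rat.cast_max, Rat.cast_min]
    rw [hinter] at hne ⊢
    exact ⟨_, _, by exact_mod_cast (Set.nonempty_Ioc.1 hne).le, rfl⟩
  · rintro _ ⟨a, b, -, rfl⟩
    exact measurableSet_Ioc
  · intro u hu x hx
    obtain ⟨c, d, ⟨hcx, hxd⟩, hsub⟩ := mem_nhds_iff_exists_Ioo_subset.1 (hu.mem_nhds hx)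
    obtain ⟨a, hca, hax⟩ := exists_rat_btwn hcx
    obtain ⟨b, hxb, hbd⟩ := exists_rat_btwn hxd
    exact ⟨_, ⟨a, b, by exact_mod_cast (hax.trans hxb).le, rfl⟩, Ioc_mem_nhds hax hxb,
      fun y hy => hsub ⟨hca.trans hy.1, hy.2.trans_lt hbd⟩⟩
  · rintro _ ⟨a, b, hab, rfl⟩
    have hab' : (a : ℝ) ≤ b := by exact_mod_cast hab
    rw [← NNReal.tendsto_coe, measure_Ioc ν hab']
    simp_rw [measure_Ioc _ hab']
    exact (h b).sub (h a)

/- Weak convergence is usually stated along countably generated filters, which `inProb` is not.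
Hence the coarsest filter along which the distribution function converges at the rationals. -/
lemma tendsto_probabilityMeasure_of_tendsto_cdf {μ : α → ProbabilityMeasure ℝ}
    {ν : ProbabilityMeasure ℝ}
    (h : ∀ r : ℝ, Tendsto (fun i => cdf (μ i : Measure ℝ) r) l (𝓝 (cdf (ν : Measure ℝ) r))) :
    Tendsto μ l (𝓝 ν) := by
  let cdfAt (r : ℚ) (ρ : ProbabilityMeasure ℝ) : ℝ := cdf (ρ : Measure ℝ) r
  have hweak : Tendsto id (⨅ r, comap (cdfAt r) (𝓝 (cdfAt r ν))) (𝓝 ν) :=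
    tendsto_probabilityMeasure_of_tendsto_cdf_rat fun r => tendsto_comap.mono_left (iInf_le _ r)
  exact hweak.comp (tendsto_iInf.2 fun r => tendsto_comap_iff.2 (h r))

section InnerProductSpace

variable {E : Type*} [NormedAddCommGroup E] [InnerProductSpace ℝ E] [MeasurableSpace E]
  [BorelSpace E]

lemma tendsto_charFun {μ : α → ProbabilityMeasure E} {ν : ProbabilityMeasure E}
    (h : Tendsto μ l (𝓝 ν)) (t : E) :
    Tendsto (fun i => charFun (μ i : Measure E) t) l (𝓝 (charFun (ν : Measure E) t)) := by
  simp_rw [charFun_eq_integral_innerProbChar]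
  exact (ProbabilityMeasure.tendsto_iff_forall_integral_rclike_tendsto ℂ).1 h
    (BoundedContinuousFunction.innerProbChar t)

lemma tendsto_of_tendsto_charFun [FiniteDimensional ℝ E] [l.IsCountablyGenerated]
    {μ : α → ProbabilityMeasure E} {ν : ProbabilityMeasure E}
    (h : ∀ t, Tendsto (fun i => charFun (μ i : Measure E) t) l (𝓝 (charFun (ν : Measure E) t))) :
    Tendsto μ l (𝓝 ν) :=
  tendsto_of_seq_tendsto fun _ hu =>
    ProbabilityMeasure.tendsto_of_tendsto_charFun fun t => (h t).comp hu

end InnerProductSpace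

end CharFun

section CLT

variable {α : Type*} {l : Filter α} {M : α → ℕ}

lemma tendsto_one_add_pow_exp {g : α → ℂ} {w : ℂ} (hM : Tendsto M l atTop)
    (hg : Tendsto (fun i => M i * g i) l (𝓝 w)) :
    Tendsto (fun i => (1 + g i) ^ M i) l (𝓝 (Complex.exp w)) := by
  have hg0 : Tendsto g l (𝓝 0) := by
    have hMinv : Tendsto (fun i => (M i : ℂ)⁻¹) l (𝓝 0) :=
      tendsto_inv₀_cobounded.comp (tendsto_natCast_atTop_cobounded.comp hM)
    refine (by simpa using hMinv.mul hg : Tendsto _ l (𝓝 (0 : ℂ))).congr' ?_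
    filter_upwards [hM.eventually_ne_atTop 0] with i hi
    exact inv_mul_cancel_left₀ (Nat.cast_ne_zero.2 hi) _
  have hremainder : Tendsto (fun i => M i * (Complex.log (1 + g i) - g i)) l (𝓝 0) := by
    have hO : (fun i => M i * (Complex.log (1 + g i) - g i)) =O[l] fun i => M i * g i * g i :=
      ((Asymptotics.isBigO_refl (fun i => (M i : ℂ)) l).mul
        (Complex.log_sub_self_isBigO.comp_tendsto hg0)).congr_right
        fun i => by simp only [Function.comp_apply]; ring
    exact hO.trans_tendsto (by simpa using hg.mul hg0)
  have hlog : Tendsto (fun i => M i * Complex.log (1 + g i)) l (𝓝 w) := by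
    simpa only [← mul_add, sub_add_cancel, zero_add] using hremainder.add hg
  refine ((Complex.continuous_exp.tendsto w).comp hlog).congr' ?_
  filter_upwards [hg0.eventually_ne (show (0 : ℂ) ≠ -1 by simp)] with i hi
  have hne : 1 + g i ≠ 0 := fun h => hi (by linear_combination h)
  rw [Function.comp_apply, Complex.exp_nat_mul, Complex.exp_log hne]

lemma norm_exp_mul_I_sub_taylor_le (x : ℝ) :
    ‖Complex.exp (x * Complex.I) - (1 + x * Complex.I - x ^ 2 / 2)‖ ≤ 4 * |x| ^ 3 := by
  have hnorm : ‖(x : ℂ) * Complex.I‖ = |x| := by simp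
  rcases le_or_gt |x| 1 with h | h
  · have hbound := Complex.exp_bound (hnorm.trans_le h) (n := 3) (by norm_num)
    have hsum : ∑ m ∈ Finset.range 3, ((x : ℂ) * Complex.I) ^ m / m.factorial
        = 1 + x * Complex.I - x ^ 2 / 2 := by
      simp [Finset.sum_range_succ, mul_pow, Nat.factorial]
      ring
    rw [hnorm, hsum] at hbound
    refine hbound.trans ?_
    norm_num [Nat.factorial]
    linarith [pow_nonneg (abs_nonneg x) 3]
  · have htaylor : ‖(1 : ℂ) + x * Complex.I - x ^ 2 / 2‖ ≤ 1 + |x| + |x| ^ 2 / 2 :=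
      (norm_sub_le _ _).trans (add_le_add ((norm_add_le _ _).trans (by simp)) (by simp))
    calc ‖Complex.exp (x * Complex.I) - (1 + x * Complex.I - x ^ 2 / 2)‖
        ≤ 1 + (1 + |x| + |x| ^ 2 / 2) :=
          (norm_sub_le _ _).trans (add_le_add (Complex.norm_exp_ofReal_mul_I x).le htaylor)
      _ ≤ 4 * |x| ^ 3 := by
          have : 1 ≤ |x| ^ 2 := one_le_pow₀ h.le
          have : |x| ^ 2 ≤ |x| ^ 3 := pow_le_pow_right₀ h.le (by norm_num)
          nlinarith

lemma norm_charFun_sub_taylor_le {ν : Measure ℝ} [IsProbabilityMeasure ν] (hν : MemLp id 3 ν)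
    (s : ℝ) :
    ‖charFun ν s - (1 + s * (∫ x, x ∂ν) * Complex.I - s ^ 2 * (∫ x, x ^ 2 ∂ν) / 2)‖
      ≤ 4 * |s| ^ 3 * ∫ x, |x| ^ 3 ∂ν := by
  have hint1 : Integrable (fun x => x) ν := hν.integrable (by norm_num)
  have hint2 : Integrable (fun x => x ^ 2) ν :=
    (hν.mono_exponent (by norm_num : (2 : ℝ≥0∞) ≤ 3)).integrable_sq
  have hint3 : Integrable (fun x => |x| ^ 3) ν := hν.integrable_norm_pow (by norm_num)
  have hexp : Integrable (fun x : ℝ => Complex.exp (↑(s * x) * Complex.I)) ν :=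
    .of_bound (by fun_prop) 1 (ae_of_all _ fun x => (Complex.norm_exp_ofReal_mul_I _).le)
  have hlin : Integrable (fun x : ℝ => (1 : ℂ) + ↑(s * x) * Complex.I) ν :=
    (integrable_const _).add ((hint1.const_mul s).ofReal.mul_const _)
  have hquad : Integrable (fun x : ℝ => (↑(s * x) : ℂ) ^ 2 / 2) ν := by
    refine ((hint2.const_mul (s ^ 2 / 2)).ofReal (𝕜 := ℂ)).congr (ae_of_all _ fun x => ?_)
    simp only [RCLike.ofReal_eq_complex_ofReal]
    push_cast
    ring
  have htaylor : ∫ x : ℝ, (1 + ↑(s * x) * Complex.I - (↑(s * x) : ℂ) ^ 2 / 2) ∂ν =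
      1 + s * (∫ x, x ∂ν) * Complex.I - s ^ 2 * (∫ x, x ^ 2 ∂ν) / 2 := by
    rw [integral_sub hlin hquad, integral_add (integrable_const _)
      ((hint1.const_mul s).ofReal.mul_const _), integral_mul_const, integral_div]
    simp only [← Complex.ofReal_pow, integral_complex_ofReal, mul_pow]
    rw [integral_const_mul, integral_const_mul]
    simp
  calc _ = ‖∫ x : ℝ, (Complex.exp (↑(s * x) * Complex.I)
        - (1 + ↑(s * x) * Complex.I - (↑(s * x) : ℂ) ^ 2 / 2)) ∂ν‖ := by
        rw [integral_sub (g := fun x : ℝ => 1 + ↑(s * x) * Complex.I - (↑(s * x) : ℂ) ^ 2 / 2)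
          hexp (hlin.sub hquad), htaylor, charFun_apply_real]
        simp only [Complex.ofReal_mul]
    _ ≤ ∫ x, 4 * |s| ^ 3 * |x| ^ 3 ∂ν :=
        norm_integral_le_of_norm_le (hint3.const_mul _) (ae_of_all _ fun x =>
          (norm_exp_mul_I_sub_taylor_le _).trans_eq (by rw [abs_mul]; ring))
    _ = _ := integral_const_mul _ _

/- Lyapunov's central limit theorem for a triangular array: row `i` consists of `M i` independent
copies of `ν i`, scaled by `s i`. -/
lemma tendsto_charFun_pow {ν : α → Measure ℝ} [∀ i, IsProbabilityMeasure (ν i)] {s : α → ℝ}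
    {d v C : ℝ} (hM : Tendsto M l atTop) (hs : Tendsto (fun i => M i * s i ^ 2) l (𝓝 d))
    (hmean : ∀ i, ∫ x, x ∂(ν i) = 0) (hvar : Tendsto (fun i => ∫ x, x ^ 2 ∂(ν i)) l (𝓝 v))
    (hL3 : ∀ᶠ i in l, MemLp id 3 (ν i)) (hthird : ∀ᶠ i in l, ∫ x, |x| ^ 3 ∂(ν i) ≤ C) :
    Tendsto (fun i => charFun (ν i) (s i) ^ M i) l (𝓝 (Complex.exp (-(d * v / 2)))) := by
  have hs0 : Tendsto s l (𝓝 0) := by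
    have hMinv : Tendsto (fun i => (M i : ℝ)⁻¹) l (𝓝 0) :=
      tendsto_inv_atTop_zero.comp (tendsto_natCast_atTop_atTop.comp hM)
    have hsq : Tendsto (fun i => s i ^ 2) l (𝓝 0) := by
      refine (by simpa using hMinv.mul hs : Tendsto _ l (𝓝 (0 : ℝ))).congr' ?_
      filter_upwards [hM.eventually_ne_atTop 0] with i hi
      exact inv_mul_cancel_left₀ (Nat.cast_ne_zero.2 hi) _
    rw [tendsto_zero_iff_abs_tendsto_zero]
    simpa [Function.comp_def, Real.sqrt_sq_eq_abs] using (Real.continuous_sqrt.tendsto 0).comp hsq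
  have hremainder : Tendsto (fun i => (M i : ℂ) *
      (charFun (ν i) (s i) - (1 - s i ^ 2 * (∫ x, x ^ 2 ∂(ν i)) / 2))) l (𝓝 0) := by
    refine squeeze_zero_norm' (a := fun i => 4 * C * (M i * s i ^ 2) * |s i|) ?_
      (by simpa using (hs.const_mul (4 * C)).mul hs0.abs)
    filter_upwards [hL3, hthird] with i hi hiC
    have htaylor := norm_charFun_sub_taylor_le hi (s i)
    rw [hmean i, Complex.ofReal_zero, mul_zero, zero_mul, add_zero] at htaylor
    rw [norm_mul, Complex.norm_natCast]
    calc _ ≤ (M i : ℝ) * (4 * |s i| ^ 3 * C) := by gcongr; exact htaylor.trans (by gcongr)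
      _ = _ := by rw [← sq_abs (s i)]; ring
  have hmain : Tendsto (fun i => -((M i * s i ^ 2) * (∫ x, x ^ 2 ∂(ν i)) / 2 : ℂ)) l
      (𝓝 (-(d * v / 2))) := by
    exact_mod_cast (Complex.continuous_ofReal.tendsto _).comp ((hs.mul hvar).div_const 2).neg
  have hg : Tendsto (fun i => M i * (charFun (ν i) (s i) - 1)) l (𝓝 (-(d * v / 2) : ℂ)) := by
    refine (by simpa using hremainder.add hmain : Tendsto _ l (𝓝 _)).congr fun i => ?_
    ring
  simpa using tendsto_one_add_pow_exp hM hg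

end CLT

section Runs

variable {𝒳 𝒰 : Type*} [MeasurableSpace 𝒳] [MeasurableSpace 𝒰] {ψ : ProbabilityMeasure 𝒳 → ℝ}
  {run : ProbabilityMeasure 𝒳 → 𝒰 → ℝ} {η : Measure 𝒰} {Q : ProbabilityMeasure 𝒳}

/-- The law of the error `run Q ξ - ψ Q` of a single computation run driven by `Q`. -/
noncomputable def runErrLaw (ψ : ProbabilityMeasure 𝒳 → ℝ) (run : ProbabilityMeasure 𝒳 → 𝒰 → ℝ)
    (η : Measure 𝒰) (Q : ProbabilityMeasure 𝒳) : Measure ℝ :=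
  η.map fun u => run Q u - ψ Q

/-- The characteristic function at `c` of the error of an average of `M` runs driven by `Q`. -/
noncomputable def runMeanErrCharFun (ψ : ProbabilityMeasure 𝒳 → ℝ)
    (run : ProbabilityMeasure 𝒳 → 𝒰 → ℝ) (η : Measure 𝒰) (M : ℕ) (c : ℝ)
    (Q : ProbabilityMeasure 𝒳) : ℂ :=
  ∫ ξ : Fin M → 𝒰, Complex.exp ((c * (runMean run Q ξ - ψ Q) : ℝ) * Complex.I)
    ∂(Measure.pi fun _ => η)

lemma norm_integral_exp_mul_I_le_one {Ω : Type*} [MeasurableSpace Ω] (μ : Measure Ω)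
    [IsProbabilityMeasure μ] (f : Ω → ℝ) : ‖∫ ω, Complex.exp (f ω * Complex.I) ∂μ‖ ≤ 1 := by
  simpa using norm_integral_le_of_norm_le_const (μ := μ)
    (ae_of_all _ fun ω => (Complex.norm_exp_ofReal_mul_I (f ω)).le)

lemma integral_exp_sum_mul_I {ι : Type*} [Fintype ι] {E : ι → Type*} [∀ i, MeasurableSpace (E i)]
    (μ : ∀ i, Measure (E i)) [∀ i, SigmaFinite (μ i)] (f : ∀ i, E i → ℝ) :
    ∫ x : ∀ i, E i, Complex.exp ((∑ i, f i (x i) : ℝ) * Complex.I) ∂(Measure.pi μ) =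
      ∏ i, ∫ y, Complex.exp (f i y * Complex.I) ∂(μ i) := by
  rw [← integral_fintype_prod_eq_prod]
  simp only [Complex.ofReal_sum, Finset.sum_mul, Complex.exp_sum]

lemma integral_sq_runErrLaw (hQ : Integrable (run Q) η) (hψ : ∫ u, run Q u ∂η = ψ Q) :
    ∫ x, x ^ 2 ∂(runErrLaw ψ run η Q) = (runVar run η Q).toReal := by
  rw [runErrLaw, integral_map (hQ.aemeasurable.sub_const _) (by fun_prop), runVar, ← variance,
    variance_eq_integral hQ.aemeasurable, hψ]

lemma integral_abs_pow_three_runErrLaw (hQ : Integrable (run Q) η) :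
    ∫ x, |x| ^ 3 ∂(runErrLaw ψ run η Q) = (runThirdMoment ψ run η Q).toReal := by
  have hmeas := hQ.aemeasurable.sub_const (ψ Q)
  rw [runErrLaw, integral_map hmeas (by fun_prop), runThirdMoment,
    integral_eq_lintegral_of_nonneg_ae (ae_of_all _ fun u => by positivity)
      (hmeas.abs.pow_const 3).aestronglyMeasurable]

lemma memLp_three_runErrLaw (hQ : Integrable (run Q) η) (h3 : runThirdMoment ψ run η Q < ∞) :
    MemLp id 3 (runErrLaw ψ run η Q) := by
  have hmeas := hQ.aemeasurable.sub_const (ψ Q)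
  have hint : Integrable (fun u => |run Q u - ψ Q| ^ 3) η :=
    (lintegral_ofReal_ne_top_iff_integrable (hmeas.abs.pow_const 3).aestronglyMeasurable
      (ae_of_all _ fun u => by positivity)).1 h3.ne
  rw [runErrLaw, memLp_map_measure_iff (by fun_prop) hmeas]
  exact (integrable_norm_rpow_iff hmeas.aestronglyMeasurable (by norm_num) (by norm_num)).1
    (by simpa using hint)

section ProbabilityMeasure

variable [IsProbabilityMeasure η]

lemma isProbabilityMeasure_runErrLaw (hQ : Integrable (run Q) η) :
    IsProbabilityMeasure (runErrLaw ψ run η Q) :=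
  Measure.isProbabilityMeasure_map (hQ.aemeasurable.sub_const _)

lemma integral_id_runErrLaw (hQ : Integrable (run Q) η) (hψ : ∫ u, run Q u ∂η = ψ Q) :
    ∫ x, x ∂(runErrLaw ψ run η Q) = 0 := by
  rw [runErrLaw, integral_map (hQ.aemeasurable.sub_const _) (by fun_prop),
    integral_sub hQ (integrable_const _), hψ]
  simp

lemma norm_runMeanErrCharFun_le_one (M : ℕ) (c : ℝ) :
    ‖runMeanErrCharFun ψ run η M c Q‖ ≤ 1 :=
  norm_integral_exp_mul_I_le_one _ _

lemma runMeanErrCharFun_eq_charFun_pow (hQ : Integrable (run Q) η) {M : ℕ} (hM : M ≠ 0) (c : ℝ) :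
    runMeanErrCharFun ψ run η M c Q = charFun (runErrLaw ψ run η Q) (c / M) ^ M := by
  have herr (ξ : Fin M → 𝒰) :
      c * (runMean run Q ξ - ψ Q) = ∑ r, c / M * (run Q (ξ r) - ψ Q) := by
    rw [← Finset.mul_sum, Finset.sum_sub_distrib, runMean]
    simp only [Finset.sum_const, Finset.card_univ, Fintype.card_fin, nsmul_eq_mul]
    field_simp
  simp only [runMeanErrCharFun, herr]
  rw [integral_exp_sum_mul_I (fun _ => η) fun _ u => c / M * (run Q u - ψ Q),
    Finset.prod_const, Finset.card_univ, Fintype.card_fin, charFun_apply_real, runErrLaw,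
    integral_map (hQ.aemeasurable.sub_const _) (by fun_prop)]
  simp only [Complex.ofReal_mul]

end ProbabilityMeasure

lemma tendsto_atTop_of_tendsto_div {α : Type*} {l : Filter α} {M : α → ℕ} {n : α → ℕ+} {p : ℝ}
    (hp : 0 < p) (hn : Tendsto n l atTop) (hM : Tendsto (fun i => (M i : ℝ) / n i) l (𝓝 p)) :
    Tendsto M l atTop := by
  have hn' : Tendsto (fun i => (n i : ℝ)) l atTop :=
    tendsto_natCast_atTop_atTop.comp (tendsto_PNat_val_atTop_atTop.comp hn)
  exact tendsto_natCast_atTop_iff.1 ((hM.pos_mul_atTop hp hn').congr fun i =>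
    div_mul_cancel₀ _ (Nat.cast_ne_zero.2 (n i).ne_zero))

lemma tendsto_runMeanErrCharFun [IsProbabilityMeasure η]
    (hunbiased : ∀ Q, Integrable (run Q) η ∧ ∫ u, run Q u ∂η = ψ Q) {α : Type*} {l : Filter α}
    {Q : α → ProbabilityMeasure 𝒳} {n : α → ℕ+} {M : α → ℕ} {p : ℝ} {v k : ℝ≥0∞} (hp : 0 < p)
    (hv : v ≠ ∞) (hk : k < ∞) (hn : Tendsto n l atTop)
    (hM : Tendsto (fun i => (M i : ℝ) / n i) l (𝓝 p))
    (hQv : Tendsto (fun i => runVar run η (Q i)) l (𝓝 v))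
    (hQk : Tendsto (fun i => runThirdMoment ψ run η (Q i)) l (𝓝 k)) (a : ℝ) :
    Tendsto (fun i => runMeanErrCharFun ψ run η (M i) (a * √(n i : ℝ)) (Q i)) l
      (𝓝 (Complex.exp (-(a ^ 2 / p * v.toReal / 2) : ℝ))) := by
  have hMtop := tendsto_atTop_of_tendsto_div hp hn hM
  have hM0 : ∀ᶠ i in l, M i ≠ 0 := hMtop.eventually_ne_atTop 0
  have hscale : Tendsto (fun i => M i * (a * √(n i : ℝ) / M i) ^ 2) l (𝓝 (a ^ 2 / p)) := by
    refine ((tendsto_const_nhds (x := a ^ 2)).div hM hp.ne').congr' ?_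
    filter_upwards [hM0] with i hi
    rw [Pi.div_apply, div_pow, mul_pow, Real.sq_sqrt (by positivity)]
    field_simp
  have hprob (i : α) : IsProbabilityMeasure (runErrLaw ψ run η (Q i)) :=
    isProbabilityMeasure_runErrLaw (hunbiased (Q i)).1
  have hclt := tendsto_charFun_pow (ν := fun i => runErrLaw ψ run η (Q i)) (v := v.toReal)
    (C := k.toReal + 1) hMtop hscale
    (fun i => integral_id_runErrLaw (hunbiased (Q i)).1 (hunbiased (Q i)).2)
    (((ENNReal.tendsto_toReal hv).comp hQv).congr fun i =>
      (integral_sq_runErrLaw (hunbiased (Q i)).1 (hunbiased (Q i)).2).symm)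
    ((hQk.eventually_lt_const hk).mono fun i hi => memLp_three_runErrLaw (hunbiased (Q i)).1 hi)
    ((((ENNReal.tendsto_toReal hk.ne).comp hQk).eventually_le_const (lt_add_one _)).mono
      fun i hi => (integral_abs_pow_three_runErrLaw (hunbiased (Q i)).1).trans_le hi)
  push_cast at hclt ⊢
  refine hclt.congr' ?_
  filter_upwards [hM0] with i hi
  exact (runMeanErrCharFun_eq_charFun_pow (hunbiased (Q i)).1 hi _).symm

end Runs

section Measurability

variable {𝒳 𝒰 : Type*} [MeasurableSpace 𝒳] [MeasurableSpace 𝒰] {ψ : ProbabilityMeasure 𝒳 → ℝ}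
  {run : ProbabilityMeasure 𝒳 → 𝒰 → ℝ} {η : Measure 𝒰} [IsProbabilityMeasure η] {n : ℕ+}
  {B R₀ R : ℕ}

lemma measurable_comp_index : Measurable fun z : (Fin n → 𝒳) × (Fin n → Fin n) => z.1 ∘ z.2 := by
  have heval : Measurable fun z : (Fin n → 𝒳) × Fin n => z.1 z.2 :=
    measurable_from_prod_countable_left fun i => measurable_pi_apply i
  exact measurable_pi_lambda _ fun j =>
    heval.comp (measurable_fst.prodMk ((measurable_pi_apply j).comp measurable_snd))

section RunMean

variable (hmeas : Measurable fun z : (Fin n → 𝒳) × 𝒰 => run (empirical z.1) z.2)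
include hmeas

lemma measurable_runMean_empirical {M : ℕ} :
    Measurable fun z : (Fin n → 𝒳) × (Fin M → 𝒰) => runMean run (empirical z.1) z.2 := by
  have hrun (r : Fin M) :
      Measurable fun z : (Fin n → 𝒳) × (Fin M → 𝒰) => run (empirical z.1) (z.2 r) :=
    hmeas.comp (f := fun z : (Fin n → 𝒳) × (Fin M → 𝒰) => (z.1, z.2 r))
      (measurable_fst.prodMk ((measurable_pi_apply r).comp measurable_snd))
  exact (Finset.measurable_fun_sum Finset.univ fun r _ => hrun r).div_const (M : ℝ)

lemma measurable_pointEst : Measurable fun ω : Outcome 𝒳 𝒰 n B R₀ R => pointEst run ω :=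
  (measurable_runMean_empirical hmeas).comp
    (f := fun ω : Outcome 𝒳 𝒰 n B R₀ R => (ω.1, ω.2.2.1)) (by fun_prop)

lemma measurable_resampleEst (b : Fin B) :
    Measurable fun ω : Outcome 𝒳 𝒰 n B R₀ R => resampleEst run ω b :=
  (measurable_runMean_empirical hmeas).comp
    (f := fun ω : Outcome 𝒳 𝒰 n B R₀ R => (ω.1 ∘ ω.2.1 b, ω.2.2.2 b))
    ((measurable_comp_index.comp (f := fun ω : Outcome 𝒳 𝒰 n B R₀ R => (ω.1, ω.2.1 b))
      (by fun_prop)).prodMk (by fun_prop))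

variable (hψ : ∀ x : Fin n → 𝒳, ∫ u, run (empirical x) u ∂η = ψ (empirical x))
include hψ

lemma measurable_functional_empirical : Measurable fun x : Fin n → 𝒳 => ψ (empirical x) := by
  simpa only [hψ] using (hmeas.stronglyMeasurable.integral_prod_right' (ν := η)).measurable

lemma measurable_runMeanErrCharFun_empirical (M : ℕ) (c : ℝ) :
    Measurable fun x : Fin n → 𝒳 => runMeanErrCharFun ψ run η M c (empirical x) := by
  have hmean := measurable_runMean_empirical hmeas (M := M)
  have hfun : Measurable fun z : (Fin n → 𝒳) × (Fin M → 𝒰) => ψ (empirical z.1) :=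
    (measurable_functional_empirical hmeas hψ).comp measurable_fst
  have hexp : Measurable fun z : (Fin n → 𝒳) × (Fin M → 𝒰) => Complex.exp
      ((c * (runMean run (empirical z.1) z.2 - ψ (empirical z.1)) : ℝ) * Complex.I) :=
    Complex.measurable_exp.comp ((Complex.measurable_ofReal.comp
      ((hmean.sub hfun).const_mul c)).mul_const _)
  exact (hexp.stronglyMeasurable.integral_prod_right' (ν := Measure.pi fun _ => η)).measurable

lemma measurable_functional_resampled :
    Measurable fun z : (Fin n → 𝒳) × (Fin n → Fin n) => ψ (resampled z.1 z.2) :=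
  (measurable_functional_empirical hmeas hψ).comp measurable_comp_index

lemma measurable_runMeanErrCharFun_resampled (M : ℕ) (c : ℝ) :
    Measurable fun z : (Fin n → 𝒳) × (Fin n → Fin n) =>
      runMeanErrCharFun ψ run η M c (resampled z.1 z.2) :=
  (measurable_runMeanErrCharFun_empirical hmeas hψ M c).comp measurable_comp_index

end RunMean

end Measurability

section JointCharFun

variable {ι : Type*} [Fintype ι]

/-- The characteristic function of a law on `ℝ × ℝ × ℝ^ι`, the space of the errors of the
procedure. Mathlib's `charFun` would need an inner product on that space. -/
noncomputable def jointCharFun (μ : Measure (ℝ × ℝ × (ι → ℝ))) (r s : ℝ) (t : ι → ℝ) : ℂ :=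
  ∫ z, Complex.exp ((r * z.1 + (s * z.2.1 + ∑ b, t b * z.2.2 b) : ℝ) * Complex.I) ∂μ

lemma tendsto_of_tendsto_jointCharFun {α : Type*} {l : Filter α} [l.IsCountablyGenerated]
    {μ : α → ProbabilityMeasure (ℝ × ℝ × (ι → ℝ))} {ν : ProbabilityMeasure (ℝ × ℝ × (ι → ℝ))}
    (h : ∀ r s (t : ι → ℝ), Tendsto
      (fun i => jointCharFun (μ i : Measure (ℝ × ℝ × (ι → ℝ))) r s t) l
      (𝓝 (jointCharFun (ν : Measure (ℝ × ℝ × (ι → ℝ))) r s t))) :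
    Tendsto μ l (𝓝 ν) := by
  let e (z : ℝ × ℝ × (ι → ℝ)) : WithLp 2 (ℝ × WithLp 2 (ℝ × EuclideanSpace ℝ ι)) :=
    WithLp.toLp 2 (z.1, WithLp.toLp 2 (z.2.1, WithLp.toLp 2 z.2.2))
  let e' (w : WithLp 2 (ℝ × WithLp 2 (ℝ × EuclideanSpace ℝ ι))) : ℝ × ℝ × (ι → ℝ) :=
    (w.fst, w.snd.fst, w.snd.snd)
  have he : Continuous e := by fun_prop
  have he' : Continuous e' := by fun_prop
  have hcharFun (ρ : ProbabilityMeasure (ℝ × ℝ × (ι → ℝ)))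
      (w : WithLp 2 (ℝ × WithLp 2 (ℝ × EuclideanSpace ℝ ι))) :
      charFun (ρ.map he.aemeasurable : Measure _) w =
        jointCharFun (ρ : Measure (ℝ × ℝ × (ι → ℝ))) w.fst w.snd.fst w.snd.snd := by
    rw [ProbabilityMeasure.toMeasure_map, charFun_apply, integral_map he.aemeasurable (by fun_prop)]
    simp [jointCharFun, e, WithLp.prod_inner_apply, PiLp.inner_apply]
  have hlim : Tendsto (fun i => (μ i).map he.aemeasurable) l (𝓝 (ν.map he.aemeasurable)) :=
    tendsto_of_tendsto_charFun fun w => by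
      simpa only [hcharFun] using h w.fst w.snd.fst w.snd.snd
  have hinv (ρ : ProbabilityMeasure (ℝ × ℝ × (ι → ℝ))) :
      (ρ.map he.aemeasurable).map he'.aemeasurable = ρ :=
    ProbabilityMeasure.toMeasure_injective <|
      (Measure.map_map he'.measurable he.measurable).trans Measure.map_id
  simpa only [hinv] using
    ProbabilityMeasure.tendsto_map_of_tendsto_of_continuous _ _ hlim he'

end JointCharFun

section NormalLaw

/-- The law of `(c Z₁, s Z₂, (k W_b)_b)` for independent standard normal `Z₁, Z₂, W₁, …, W_B`. -/
noncomputable def scaledNormalLaw (B : ℕ) (c s k : ℝ) : Measure (ℝ × ℝ × (Fin B → ℝ)) :=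
  ((gaussianReal 0 1).prod ((gaussianReal 0 1).prod (Measure.pi fun _ => gaussianReal 0 1))).map
    fun z => (c * z.1, s * z.2.1, fun b => k * z.2.2 b)

instance (B : ℕ) (c s k : ℝ) : IsProbabilityMeasure (scaledNormalLaw B c s k) :=
  Measure.isProbabilityMeasure_map (by fun_prop)

lemma integral_exp_const_mul_gaussianReal (a : ℝ) :
    ∫ x, Complex.exp ((a * x : ℝ) * Complex.I) ∂(gaussianReal 0 1) =
      Complex.exp (-(a ^ 2 / 2) : ℝ) := by
  have := charFun_gaussianReal (μ := 0) (v := 1) a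
  rw [charFun_apply_real] at this
  push_cast
  rw [this]
  simp

lemma jointCharFun_scaledNormalLaw (B : ℕ) (c s k r u : ℝ) (t : Fin B → ℝ) :
    jointCharFun (scaledNormalLaw B c s k) r u t =
      Complex.exp (-((r * c) ^ 2 / 2) : ℝ) * (Complex.exp (-((u * s) ^ 2 / 2) : ℝ) *
        ∏ b, Complex.exp (-((t b * k) ^ 2 / 2) : ℝ)) := by
  rw [jointCharFun, scaledNormalLaw, integral_map (by fun_prop) (by fun_prop)]
  have hscale (a b x : ℝ) : a * (b * x) = a * b * x := (mul_assoc a b x).symm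
  simp only [hscale, Complex.ofReal_add, add_mul, Complex.exp_add]
  rw [integral_prod_mul (f := fun x : ℝ => Complex.exp ((r * c * x : ℝ) * Complex.I))
    (g := fun z : ℝ × (Fin B → ℝ) => Complex.exp ((u * s * z.1 : ℝ) * Complex.I) *
      Complex.exp ((∑ b, t b * k * z.2 b : ℝ) * Complex.I)),
    integral_prod_mul (f := fun x : ℝ => Complex.exp ((u * s * x : ℝ) * Complex.I))
    (g := fun z : Fin B → ℝ => Complex.exp ((∑ b, t b * k * z b : ℝ) * Complex.I)),
    integral_exp_sum_mul_I (fun _ => gaussianReal 0 1) fun b x => t b * k * x]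
  simp only [integral_exp_const_mul_gaussianReal]

end NormalLaw

section Errors

variable {𝒳 𝒰 : Type*} [MeasurableSpace 𝒳] [MeasurableSpace 𝒰] {ψ : ProbabilityMeasure 𝒳 → ℝ}
  {run : ProbabilityMeasure 𝒳 → 𝒰 → ℝ} {η : Measure 𝒰} {P : ProbabilityMeasure 𝒳} {n : ℕ+}
  {B R₀ R : ℕ}

instance (n : ℕ+) : IsProbabilityMeasure (resampleLaw n) := by
  have : IsProbabilityMeasure (uniformOn (Set.univ : Set (Fin n))) :=
    isProbabilityMeasure_uniformOn Set.finite_univ ⟨⟨0, n.pos⟩, Set.mem_univ _⟩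
  unfold resampleLaw
  infer_instance

instance (P : ProbabilityMeasure 𝒳) (η : Measure 𝒰) [IsProbabilityMeasure η] (n : ℕ+)
    (B R₀ R : ℕ) : IsProbabilityMeasure (outcomeLaw P η n B R₀ R) := by
  unfold outcomeLaw
  infer_instance

/-- The law of the inputs of the computation: the data and the indices of the `B` resamples. -/
noncomputable abbrev inputLaw (P : ProbabilityMeasure 𝒳) (n : ℕ+) (B : ℕ) :
    Measure ((Fin n → 𝒳) × (Fin B → Fin n → Fin n)) :=
  (dataLaw P n).prod (Measure.pi fun _ => resampleLaw n)

/-- The law of the resampling error `√n (ψ(Pₙ*) - ψ(P̂ₙ))`, given the data `x`. -/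
noncomputable def resampleErrLaw (ψ : ProbabilityMeasure 𝒳 → ℝ) (x : Fin n → 𝒳) : Measure ℝ :=
  (resampleLaw n).map fun I => √(n : ℝ) * (ψ (resampled x I) - ψ (empirical x))

/-- The errors of the procedure on the scale `√n`: of `ψ(P̂ₙ)` as an estimate of `ψ(P)`, and of the
original estimate and the resample estimates as estimates of `ψ(P̂ₙ)`. -/
noncomputable def errVec (ψ : ProbabilityMeasure 𝒳 → ℝ) (run : ProbabilityMeasure 𝒳 → 𝒰 → ℝ)
    (P : ProbabilityMeasure 𝒳) (ω : Outcome 𝒳 𝒰 n B R₀ R) : ℝ × ℝ × (Fin B → ℝ) :=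
  (√(n : ℝ) * (ψ (empirical ω.1) - ψ P), √(n : ℝ) * (pointEst run ω - ψ (empirical ω.1)),
    fun b => √(n : ℝ) * (resampleEst run ω b - ψ (empirical ω.1)))

instance (x : Fin n → 𝒳) : IsProbabilityMeasure (resampleErrLaw ψ x) :=
  Measure.isProbabilityMeasure_map (measurable_of_finite _).aemeasurable

lemma charFun_resampleErrLaw (x : Fin n → 𝒳) (a : ℝ) :
    charFun (resampleErrLaw ψ x) a =
      ∫ I, Complex.exp ((a * (√(n : ℝ) * (ψ (resampled x I) - ψ (empirical x))) : ℝ) * Complex.I)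
        ∂(resampleLaw n) := by
  rw [charFun_apply_real, resampleErrLaw,
    integral_map (measurable_of_finite _).aemeasurable (by fun_prop)]
  simp only [Complex.ofReal_mul]

lemma charFun_gaussianReal_zero_sq (σ : ℝ≥0) (a : ℝ) :
    charFun (gaussianReal 0 (σ ^ 2)) a = Complex.exp (-((a * σ) ^ 2 / 2) : ℝ) := by
  rw [charFun_gaussianReal]
  push_cast
  ring_nf

lemma tendsto_charFun_resampleErrLaw {σ : ℝ≥0} (hboot : BootstrapValidity ψ P σ) (a : ℝ) :
    Tendsto (fun z : Σ n : ℕ+, Fin n → 𝒳 => charFun (resampleErrLaw ψ z.2) a)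
      (inProb atTop (dataLaw P)) (𝓝 (Complex.exp (-((a * σ) ^ 2 / 2) : ℝ))) := by
  have hcdf (z : Σ n : ℕ+, Fin n → 𝒳) (t : ℝ) : cdf (resampleErrLaw ψ z.2) t =
      (resampleLaw z.1).real {I | √(z.1 : ℝ) * (ψ (resampled z.2 I) - ψ (empirical z.2)) ≤ t} := by
    rw [cdf_eq_real, resampleErrLaw, map_measureReal_apply (measurable_of_finite _)
      measurableSet_Iic]
    rfl
  rw [← charFun_gaussianReal_zero_sq]
  refine tendsto_charFun
    (μ := fun z : Σ n : ℕ+, Fin n → 𝒳 => ⟨resampleErrLaw ψ z.2, inferInstance⟩)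
    (ν := ⟨gaussianReal 0 (σ ^ 2), inferInstance⟩)
    (tendsto_probabilityMeasure_of_tendsto_cdf fun t => ?_) a
  have hresample := tendstoInProb_iff_tendsto.1 (hboot.resample t)
  simpa only [ProbabilityMeasure.coe_mk, hcdf] using hresample

end Errors

section Conditioning

variable {𝒳 𝒰 : Type*} [MeasurableSpace 𝒳] [MeasurableSpace 𝒰] {ψ : ProbabilityMeasure 𝒳 → ℝ}
  {run : ProbabilityMeasure 𝒳 → 𝒰 → ℝ} {η : Measure 𝒰} [IsProbabilityMeasure η]
  {P : ProbabilityMeasure 𝒳} {n : ℕ+} {B R₀ R : ℕ}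

/-- The linear combination of the input errors `√n (ψ(P̂ₙ) - ψ(P))` and
`√n (ψ(Pₙ*ᵇ) - ψ(P̂ₙ))` with coefficients `r` and `t b`. -/
noncomputable def inputErr (ψ : ProbabilityMeasure 𝒳 → ℝ) (P : ProbabilityMeasure 𝒳) (r : ℝ)
    (t : Fin B → ℝ) (z : (Fin n → 𝒳) × (Fin B → Fin n → Fin n)) : ℝ :=
  r * (√(n : ℝ) * (ψ (empirical z.1) - ψ P)) +
    ∑ b, t b * (√(n : ℝ) * (ψ (resampled z.1 (z.2 b)) - ψ (empirical z.1)))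

section Measurability

variable (hmeas : Measurable fun z : (Fin n → 𝒳) × 𝒰 => run (empirical z.1) z.2)
  (hψ : ∀ x : Fin n → 𝒳, ∫ u, run (empirical x) u ∂η = ψ (empirical x))
include hmeas hψ

lemma measurable_functional_resampled_apply (b : Fin B) :
    Measurable fun z : (Fin n → 𝒳) × (Fin B → Fin n → Fin n) => ψ (resampled z.1 (z.2 b)) :=
  (measurable_functional_resampled hmeas hψ).comp
    (f := fun z : (Fin n → 𝒳) × (Fin B → Fin n → Fin n) => (z.1, z.2 b)) (by fun_prop)

lemma measurable_inputErr (r : ℝ) (t : Fin B → ℝ) :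
    Measurable fun z : (Fin n → 𝒳) × (Fin B → Fin n → Fin n) => inputErr ψ P r t z := by
  have hdata : Measurable fun z : (Fin n → 𝒳) × (Fin B → Fin n → Fin n) => ψ (empirical z.1) :=
    (measurable_functional_empirical hmeas hψ).comp measurable_fst
  have hres (b : Fin B) := measurable_functional_resampled_apply hmeas hψ b
  exact (((hdata.sub_const _).const_mul _).const_mul r).add
    (Finset.measurable_fun_sum _ fun b _ => (((hres b).sub hdata).const_mul _).const_mul (t b))

lemma measurable_errVec :
    Measurable fun ω : Outcome 𝒳 𝒰 n B R₀ R => errVec ψ run P ω := by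
  have hdata : Measurable fun ω : Outcome 𝒳 𝒰 n B R₀ R => ψ (empirical ω.1) :=
    (measurable_functional_empirical hmeas hψ).comp measurable_fst
  exact ((hdata.sub_const _).const_mul _).prodMk
    ((((measurable_pointEst hmeas).sub hdata).const_mul _).prodMk
      (measurable_pi_lambda _ fun b => ((measurable_resampleEst hmeas b).sub hdata).const_mul _))

end Measurability

lemma integral_exp_runMeanErr (Q₀ : ProbabilityMeasure 𝒳) (Q : Fin B → ProbabilityMeasure 𝒳)
    (s : ℝ) (t : Fin B → ℝ) :
    ∫ ξ, Complex.exp ((s * (runMean run Q₀ ξ.1 - ψ Q₀) +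
        ∑ b, t b * (runMean run (Q b) (ξ.2 b) - ψ (Q b)) : ℝ) * Complex.I)
      ∂((Measure.pi fun _ : Fin R₀ => η).prod
        (Measure.pi fun _ : Fin B => Measure.pi fun _ : Fin R => η)) =
      runMeanErrCharFun ψ run η R₀ s Q₀ * ∏ b, runMeanErrCharFun ψ run η R (t b) (Q b) := by
  simp only [Complex.ofReal_add, add_mul, Complex.exp_add]
  rw [integral_prod_mul
    (f := fun ξ : Fin R₀ → 𝒰 =>
      Complex.exp ((s * (runMean run Q₀ ξ - ψ Q₀) : ℝ) * Complex.I))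
    (g := fun ξ : Fin B → Fin R → 𝒰 =>
      Complex.exp ((∑ b, t b * (runMean run (Q b) (ξ b) - ψ (Q b)) : ℝ) * Complex.I)),
    integral_exp_sum_mul_I (fun _ => Measure.pi fun _ => η)
      fun b ξ => t b * (runMean run (Q b) ξ - ψ (Q b))]
  rfl

omit [MeasurableSpace 𝒰] in
lemma linear_errVec_eq_inputErr_add (ω : Outcome 𝒳 𝒰 n B R₀ R) (r s : ℝ) (t : Fin B → ℝ) :
    r * (errVec ψ run P ω).1 +
        (s * (errVec ψ run P ω).2.1 + ∑ b, t b * (errVec ψ run P ω).2.2 b) =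
      inputErr ψ P r t (ω.1, ω.2.1) +
        (s * √(n : ℝ) * (runMean run (empirical ω.1) ω.2.2.1 - ψ (empirical ω.1)) +
          ∑ b, t b * √(n : ℝ) * (runMean run (resampled ω.1 (ω.2.1 b)) (ω.2.2.2 b) -
            ψ (resampled ω.1 (ω.2.1 b)))) := by
  have hsplit (b : Fin B) : t b * (errVec ψ run P ω).2.2 b =
      t b * (√(n : ℝ) * (ψ (resampled ω.1 (ω.2.1 b)) - ψ (empirical ω.1))) +
        t b * √(n : ℝ) * (runMean run (resampled ω.1 (ω.2.1 b)) (ω.2.2.2 b) -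
          ψ (resampled ω.1 (ω.2.1 b))) := by
    simp only [errVec, resampleEst]
    ring
  simp only [hsplit, Finset.sum_add_distrib]
  simp only [inputErr, errVec, pointEst]
  ring

lemma jointCharFun_law_errVec
    (hmeas : Measurable fun z : (Fin n → 𝒳) × 𝒰 => run (empirical z.1) z.2)
    (hψ : ∀ x : Fin n → 𝒳, ∫ u, run (empirical x) u ∂η = ψ (empirical x))
    (r s : ℝ) (t : Fin B → ℝ) :
    jointCharFun ((outcomeLaw P η n B R₀ R).map (errVec ψ run P)) r s t =
      ∫ z, Complex.exp (inputErr ψ P r t z * Complex.I) *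
        (runMeanErrCharFun ψ run η R₀ (s * √(n : ℝ)) (empirical z.1) *
          ∏ b, runMeanErrCharFun ψ run η R (t b * √(n : ℝ)) (resampled z.1 (z.2 b)))
        ∂(inputLaw P n B) := by
  let f (ω : Outcome 𝒳 𝒰 n B R₀ R) : ℂ := Complex.exp (((r * (errVec ψ run P ω).1 +
    (s * (errVec ψ run P ω).2.1 + ∑ b, t b * (errVec ψ run P ω).2.2 b) : ℝ) : ℂ) * Complex.I)
  have herr : Measurable fun ω : Outcome 𝒳 𝒰 n B R₀ R => errVec ψ run P ω :=
    measurable_errVec hmeas hψ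
  have hf : Measurable f := (by fun_prop : Measurable fun z : ℝ × ℝ × (Fin B → ℝ) =>
    Complex.exp ((r * z.1 + (s * z.2.1 + ∑ b, t b * z.2.2 b) : ℝ) * Complex.I)).comp herr
  rw [jointCharFun, integral_map herr.aemeasurable (by fun_prop)]
  refine ((measurePreserving_prodAssoc (dataLaw P n) (Measure.pi fun _ => resampleLaw n)
    ((Measure.pi fun _ => η).prod (Measure.pi fun _ => Measure.pi fun _ => η))).integral_comp'
      f).symm.trans ?_
  rw [integral_prod _ (show Integrable (fun z => f (MeasurableEquiv.prodAssoc z)) _ from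
    .of_bound (hf.comp MeasurableEquiv.prodAssoc.measurable).aestronglyMeasurable 1
      (ae_of_all _ fun z => (Complex.norm_exp_ofReal_mul_I _).le))]
  refine integral_congr_ae (ae_of_all _ fun z => ?_)
  simp only [f, linear_errVec_eq_inputErr_add]
  simp only [Complex.ofReal_add (inputErr ψ P r t _), add_mul (inputErr ψ P r t _ : ℂ),
    Complex.exp_add]
  rw [← integral_exp_runMeanErr, ← integral_const_mul]
  rfl

end Conditioning

section Limit

variable {𝒳 𝒰 : Type*} [MeasurableSpace 𝒳] [MeasurableSpace 𝒰] {ψ : ProbabilityMeasure 𝒳 → ℝ}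
  {run : ProbabilityMeasure 𝒳 → 𝒰 → ℝ} {η : Measure 𝒰} [IsProbabilityMeasure η]
  {P : ProbabilityMeasure 𝒳} {σ : ℝ≥0} {B : ℕ}

lemma integral_exp_inputErr {n : ℕ+}
    (hmeas : Measurable fun z : (Fin n → 𝒳) × 𝒰 => run (empirical z.1) z.2)
    (hψ : ∀ x : Fin n → 𝒳, ∫ u, run (empirical x) u ∂η = ψ (empirical x))
    (r : ℝ) (t : Fin B → ℝ) :
    ∫ z, Complex.exp (inputErr ψ P r t z * Complex.I) ∂(inputLaw P n B) =
      ∫ x, Complex.exp ((r * (√(n : ℝ) * (ψ (empirical x) - ψ P)) : ℝ) * Complex.I) *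
        ∏ b, charFun (resampleErrLaw ψ x) (t b) ∂(dataLaw P n) := by
  have hexp : Measurable fun z : (Fin n → 𝒳) × (Fin B → Fin n → Fin n) =>
      Complex.exp (inputErr ψ P r t z * Complex.I) := by
    have := measurable_inputErr (P := P) hmeas hψ r t
    fun_prop
  rw [integral_prod _ (.of_bound hexp.aestronglyMeasurable 1
    (ae_of_all _ fun z => (Complex.norm_exp_ofReal_mul_I _).le))]
  refine integral_congr_ae (ae_of_all _ fun x => ?_)
  simp only [inputErr, Complex.ofReal_add, add_mul, Complex.exp_add]
  rw [integral_const_mul, integral_exp_sum_mul_I (fun _ => resampleLaw n) fun b I =>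
    t b * (√(n : ℝ) * (ψ (resampled x I) - ψ (empirical x)))]
  simp only [charFun_resampleErrLaw]

lemma measurable_charFun_resampleErrLaw {n : ℕ+}
    (hmeas : Measurable fun z : (Fin n → 𝒳) × 𝒰 => run (empirical z.1) z.2)
    (hψ : ∀ x : Fin n → 𝒳, ∫ u, run (empirical x) u ∂η = ψ (empirical x)) (a : ℝ) :
    Measurable fun x : Fin n → 𝒳 => charFun (resampleErrLaw ψ x) a := by
  have herr : Measurable fun z : (Fin n → 𝒳) × (Fin n → Fin n) =>
      √(n : ℝ) * (ψ (resampled z.1 z.2) - ψ (empirical z.1)) :=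
    ((measurable_functional_resampled hmeas hψ).sub
      ((measurable_functional_empirical hmeas hψ).comp measurable_fst)).const_mul _
  have hexp : Measurable fun z : (Fin n → 𝒳) × (Fin n → Fin n) => Complex.exp
      ((a * (√(n : ℝ) * (ψ (resampled z.1 z.2) - ψ (empirical z.1))) : ℝ) * Complex.I) :=
    (by fun_prop : Measurable fun y : ℝ => Complex.exp ((a * y : ℝ) * Complex.I)).comp herr
  simp_rw [charFun_resampleErrLaw]
  exact (hexp.stronglyMeasurable.integral_prod_right' (ν := resampleLaw n)).measurable

lemma tendsto_integral_exp_originalErr (hboot : BootstrapValidity ψ P σ) (r : ℝ) :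
    Tendsto (fun n : ℕ+ =>
      ∫ x, Complex.exp ((r * (√(n : ℝ) * (ψ (empirical x) - ψ P)) : ℝ) * Complex.I)
        ∂(dataLaw P n)) atTop (𝓝 (Complex.exp (-((r * σ) ^ 2 / 2) : ℝ))) := by
  have hlim := tendsto_charFun hboot.original.tendsto r
  simp only [ProbabilityMeasure.coe_mk, Measure.map_id, charFun_gaussianReal_zero_sq] at hlim
  refine hlim.congr fun n => ?_
  rw [charFun_apply_real, integral_map (hboot.original.forall_aemeasurable n) (by fun_prop)]
  simp only [Complex.ofReal_mul]

lemma tendsto_integral_exp_inputErr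
    (hmeas : ∀ n : ℕ+, Measurable fun z : (Fin n → 𝒳) × 𝒰 => run (empirical z.1) z.2)
    (hψ : ∀ Q, ∫ u, run Q u ∂η = ψ Q) (hboot : BootstrapValidity ψ P σ) (r : ℝ) (t : Fin B → ℝ) :
    Tendsto (fun n => ∫ z, Complex.exp (inputErr ψ P r t z * Complex.I) ∂(inputLaw P n B)) atTop
      (𝓝 (Complex.exp (-((r * σ) ^ 2 / 2) : ℝ) *
        ∏ b, Complex.exp (-((t b * σ) ^ 2 / 2) : ℝ))) := by
  simp_rw [fun n => integral_exp_inputErr (P := P) (hmeas n) (fun x => hψ (empirical x)) r t]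
  refine tendsto_integral_mul_of_inProb (C := 1) (D := 1) (fun n => ?_) (fun n => ?_)
    (fun n x => (Complex.norm_exp_ofReal_mul_I _).le) (fun n x => ?_)
    (tendsto_integral_exp_originalErr hboot r)
    (tendsto_finsetProd _ fun b _ => tendsto_charFun_resampleErrLaw hboot (t b))
  · have := measurable_functional_empirical (hmeas n) fun x => hψ (empirical x)
    exact ((by fun_prop : Measurable fun y : ℝ =>
      Complex.exp ((r * (√(n : ℝ) * (y - ψ P)) : ℝ) * Complex.I)).comp this).aestronglyMeasurable
  · exact (Finset.measurable_fun_prod _ fun b _ => measurable_charFun_resampleErrLaw (hmeas n)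
      (fun x => hψ (empirical x)) (t b)).aestronglyMeasurable
  · rw [norm_prod]
    exact Finset.prod_le_one (fun _ _ => norm_nonneg _) fun b _ => norm_charFun_le_one _

lemma tendsto_runMeanErrCharFun_inProb_inputLaw
    (hunbiased : ∀ Q, Integrable (run Q) η ∧ ∫ u, run Q u ∂η = ψ Q)
    (hmom : MomentConsistency ψ run η P) {R₀ R : ℕ+ → ℕ} {p₀ p : ℝ} (hp₀ : 0 < p₀) (hp : 0 < p)
    (hR₀ : Tendsto (fun n : ℕ+ => (R₀ n : ℝ) / n) atTop (𝓝 p₀))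
    (hR : Tendsto (fun n : ℕ+ => (R n : ℝ) / n) atTop (𝓝 p)) (s : ℝ) (t : Fin B → ℝ) :
    Tendsto (fun z : Σ n : ℕ+, (Fin n → 𝒳) × (Fin B → Fin n → Fin n) =>
        runMeanErrCharFun ψ run η (R₀ z.1) (s * √(z.1 : ℝ)) (empirical z.2.1) *
          ∏ b, runMeanErrCharFun ψ run η (R z.1) (t b * √(z.1 : ℝ)) (resampled z.2.1 (z.2.2 b)))
      (inProb atTop fun n => inputLaw P n B)
      (𝓝 (Complex.exp (-(s ^ 2 / p₀ * (runVar run η P).toReal / 2) : ℝ) *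
        ∏ b, Complex.exp (-(t b ^ 2 / p * (runVar run η P).toReal / 2) : ℝ))) := by
  have hvar := tendstoInProb_iff_tendsto.1 hmom.var_original
  have hthird := tendstoInProb_iff_tendsto.1 hmom.third_original
  have hvarRes := tendstoInProb_iff_tendsto.1 hmom.var_resample
  have hthirdRes := tendstoInProb_iff_tendsto.1 hmom.third_resample
  have hdata : Tendsto (fun z : Σ n : ℕ+, Fin n → 𝒳 =>
      runMeanErrCharFun ψ run η (R₀ z.1) (s * √(z.1 : ℝ)) (empirical z.2))
      (inProb atTop (dataLaw P))
      (𝓝 (Complex.exp (-(s ^ 2 / p₀ * (runVar run η P).toReal / 2) : ℝ))) :=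
    tendsto_runMeanErrCharFun hunbiased hp₀ hmom.var_lt_top.ne hmom.third_lt_top
      tendsto_fst_inProb (hR₀.comp tendsto_fst_inProb) hvar hthird s
  have hres (b : Fin B) : Tendsto (fun z : Σ n : ℕ+, (Fin n → 𝒳) × (Fin n → Fin n) =>
      runMeanErrCharFun ψ run η (R z.1) (t b * √(z.1 : ℝ)) (resampled z.2.1 z.2.2))
      (inProb atTop fun n => (dataLaw P n).prod (resampleLaw n))
      (𝓝 (Complex.exp (-(t b ^ 2 / p * (runVar run η P).toReal / 2) : ℝ))) :=
    tendsto_runMeanErrCharFun hunbiased hp hmom.var_lt_top.ne hmom.third_lt_top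
      tendsto_fst_inProb (hR.comp tendsto_fst_inProb) hvarRes hthirdRes (t b)
  have hfst : Tendsto (Sigma.map id fun _ => Prod.fst) (inProb atTop fun n => inputLaw P n B)
      (inProb atTop (dataLaw P)) :=
    tendsto_sigmaMap_inProb fun n => measurePreserving_fst
  have heval (b : Fin B) : Tendsto (Sigma.map id fun n : ℕ+ =>
        Prod.map (id : (Fin n → 𝒳) → _) fun I : Fin B → Fin n → Fin n => I b)
      (inProb atTop fun n => inputLaw P n B)
      (inProb atTop fun n => (dataLaw P n).prod (resampleLaw n)) :=
    tendsto_sigmaMap_inProb fun n => (MeasurePreserving.id _).prod (measurePreserving_eval _ b)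
  exact (hdata.comp hfst).mul (tendsto_finsetProd _ fun b _ => (hres b).comp (heval b))

lemma tendsto_jointCharFun_law_errVec
    (hmeas : ∀ n : ℕ+, Measurable fun z : (Fin n → 𝒳) × 𝒰 => run (empirical z.1) z.2)
    (hunbiased : ∀ Q, Integrable (run Q) η ∧ ∫ u, run Q u ∂η = ψ Q)
    (hboot : BootstrapValidity ψ P σ) (hmom : MomentConsistency ψ run η P) {R₀ R : ℕ+ → ℕ}
    {p₀ p : ℝ} (hp₀ : 0 < p₀) (hp : 0 < p)
    (hR₀ : Tendsto (fun n : ℕ+ => (R₀ n : ℝ) / n) atTop (𝓝 p₀))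
    (hR : Tendsto (fun n : ℕ+ => (R n : ℝ) / n) atTop (𝓝 p)) (r s : ℝ) (t : Fin B → ℝ) :
    Tendsto (fun n => jointCharFun ((outcomeLaw P η n B (R₀ n) (R n)).map (errVec ψ run P)) r s t)
      atTop (𝓝 ((Complex.exp (-((r * σ) ^ 2 / 2) : ℝ) *
          ∏ b, Complex.exp (-((t b * σ) ^ 2 / 2) : ℝ)) *
        (Complex.exp (-(s ^ 2 / p₀ * (runVar run η P).toReal / 2) : ℝ) *
          ∏ b, Complex.exp (-(t b ^ 2 / p * (runVar run η P).toReal / 2) : ℝ)))) := by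
  have hψ (n : ℕ+) (x : Fin n → 𝒳) := (hunbiased (empirical x)).2
  simp_rw [fun n => jointCharFun_law_errVec (B := B) (R₀ := R₀ n) (R := R n) (P := P) (hmeas n)
    (hψ n) r s t]
  refine tendsto_integral_mul_of_inProb (C := 1) (D := 1) (fun n => ?_) (fun n => ?_)
    (fun n z => (Complex.norm_exp_ofReal_mul_I _).le) (fun n z => ?_)
    (tendsto_integral_exp_inputErr hmeas (fun Q => (hunbiased Q).2) hboot r t)
    (tendsto_runMeanErrCharFun_inProb_inputLaw hunbiased hmom hp₀ hp hR₀ hR s t)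
  · have := measurable_inputErr (P := P) (hmeas n) (hψ n) r t
    fun_prop
  · refine Measurable.aestronglyMeasurable (.mul ?_ (Finset.measurable_fun_prod _ fun b _ => ?_))
    · exact (measurable_runMeanErrCharFun_empirical (hmeas n) (hψ n) _ _).comp measurable_fst
    · exact (measurable_runMeanErrCharFun_resampled (hmeas n) (hψ n) _ _).comp
        (f := fun z : (Fin n → 𝒳) × (Fin B → Fin n → Fin n) => (z.1, z.2 b)) (by fun_prop)
  · rw [norm_mul, norm_prod]
    exact mul_le_one₀ (norm_runMeanErrCharFun_le_one _ _) (by positivity)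
      (Finset.prod_le_one (fun _ _ => norm_nonneg _) fun b _ => norm_runMeanErrCharFun_le_one _ _)

theorem tendsto_law_errVec
    (hmeas : ∀ n : ℕ+, Measurable fun z : (Fin n → 𝒳) × 𝒰 => run (empirical z.1) z.2)
    (hunbiased : ∀ Q, Integrable (run Q) η ∧ ∫ u, run Q u ∂η = ψ Q)
    (hboot : BootstrapValidity ψ P σ) (hmom : MomentConsistency ψ run η P) {R₀ R : ℕ+ → ℕ}
    {p₀ p : ℝ} (hp₀ : 0 < p₀) (hp : 0 < p)
    (hR₀ : Tendsto (fun n : ℕ+ => (R₀ n : ℝ) / n) atTop (𝓝 p₀))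
    (hR : Tendsto (fun n : ℕ+ => (R n : ℝ) / n) atTop (𝓝 p)) :
    Tendsto (β := ProbabilityMeasure (ℝ × ℝ × (Fin B → ℝ)))
      (fun n => ⟨(outcomeLaw P η n B (R₀ n) (R n)).map (errVec ψ run P),
        Measure.isProbabilityMeasure_map
          (measurable_errVec (hmeas n) fun x => (hunbiased (empirical x)).2).aemeasurable⟩)
      atTop (𝓝 ⟨scaledNormalLaw B σ √((runVar run η P).toReal / p₀)
        √(σ ^ 2 + (runVar run η P).toReal / p), inferInstance⟩) := by
  refine tendsto_of_tendsto_jointCharFun fun r s t => ?_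
  simp only [ProbabilityMeasure.coe_mk, jointCharFun_scaledNormalLaw]
  convert tendsto_jointCharFun_law_errVec hmeas hunbiased hboot hmom hp₀ hp hR₀ hR r s t using 2
  have hrun : (s * √((runVar run η P).toReal / p₀)) ^ 2 = s ^ 2 / p₀ * (runVar run η P).toReal := by
    rw [mul_pow, Real.sq_sqrt (by positivity)]
    ring
  have hres (b : Fin B) :
      Complex.exp (-((t b * √(σ ^ 2 + (runVar run η P).toReal / p)) ^ 2 / 2) : ℝ) =
        Complex.exp (-((t b * σ) ^ 2 / 2) : ℝ) *
          Complex.exp (-(t b ^ 2 / p * (runVar run η P).toReal / 2) : ℝ) := by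
    rw [mul_pow, Real.sq_sqrt (by positivity), ← Complex.exp_add, ← Complex.ofReal_add]
    ring_nf
  simp only [hrun, hres, Finset.prod_mul_distrib]
  ring

end Limit

section Ratio

instance (k : ℕ) : IsProbabilityMeasure (chiSq k) :=
  Measure.isProbabilityMeasure_map (Measurable.aemeasurable (by fun_prop))

lemma ae_nonneg_chiSq (k : ℕ) : ∀ᵐ y ∂(chiSq k), 0 ≤ y := by
  rw [chiSq, ae_map_iff (Measurable.aemeasurable (by fun_prop)) measurableSet_Ici]
  exact ae_of_all _ fun z => Finset.sum_nonneg fun i _ => sq_nonneg _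

/-- The joint law of the independent variables `V₁`, `V₂`, `V₃` and `Y` in `ratioLaw`. -/
noncomputable def ratioBase (B : ℕ) : Measure (ℝ × ℝ × ℝ × ℝ) :=
  (gaussianReal 0 1).prod ((gaussianReal 0 1).prod ((gaussianReal 0 1).prod (chiSq (B - 1))))

instance (B : ℕ) : IsProbabilityMeasure (ratioBase B) := by
  unfold ratioBase; infer_instance

/-- The square of the denominator of the ratio whose law is `ratioLaw`. -/
noncomputable def denSq (B : ℕ) (θ ρ : ℝ) (v : ℝ × ℝ × ℝ × ℝ) : ℝ :=
  (θ ^ 2 + ρ ^ 2) / B * (v.2.2.2 + v.2.2.1 ^ 2)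
    - 2 * √((θ ^ 2 + ρ ^ 2) / B) * v.2.2.1 * v.2.1 + v.2.1 ^ 2

/-- The ratio whose law is `ratioLaw`, as a function of `(V₁, V₂, V₃, Y)`. -/
noncomputable def ratio (B : ℕ) (θ ρ : ℝ) (v : ℝ × ℝ × ℝ × ℝ) : ℝ :=
  (θ * v.1 + v.2.1) / √(denSq B θ ρ v)

variable (B : ℕ) (θ ρ q : ℝ)

lemma measurable_denSq : Measurable (denSq B θ ρ) := by
  unfold denSq; fun_prop

lemma measurable_ratio : Measurable (ratio B θ ρ) := by
  have := measurable_denSq B θ ρ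
  unfold ratio
  fun_prop

lemma ratioLaw_eq_map : ratioLaw B θ ρ = (ratioBase B).map (ratio B θ ρ) := rfl

instance : IsProbabilityMeasure (ratioLaw B θ ρ) :=
  Measure.isProbabilityMeasure_map (μ := ratioBase B) (measurable_ratio B θ ρ).aemeasurable

lemma measureReal_lt_ratio : (ratioBase B).real {v | q < ratio B θ ρ v} = 1 - F B q θ ρ := by
  have hm : MeasurableSet {v | ratio B θ ρ v ≤ q} := measurable_ratio B θ ρ measurableSet_Iic
  rw [F, cdf_eq_real, ratioLaw_eq_map,
    map_measureReal_apply (measurable_ratio B θ ρ) measurableSet_Iic]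
  refine .trans (congrArg _ ?_) (probReal_compl_eq_one_sub hm)
  ext v
  simp

/-- The sign change of the three normal variables, which preserves their joint law. -/
def reflect (v : ℝ × ℝ × ℝ × ℝ) : ℝ × ℝ × ℝ × ℝ := (-v.1, -v.2.1, -v.2.2.1, v.2.2.2)

lemma measurePreserving_reflect : MeasurePreserving reflect (ratioBase B) (ratioBase B) := by
  have hneg : MeasurePreserving (fun x : ℝ => -x) (gaussianReal 0 1) (gaussianReal 0 1) :=
    ⟨measurable_neg, by rw [gaussianReal_map_neg, neg_zero]⟩
  exact hneg.prod (hneg.prod (hneg.prod (MeasurePreserving.id (chiSq (B - 1)))))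

lemma ratio_reflect (v : ℝ × ℝ × ℝ × ℝ) : ratio B θ ρ (reflect v) = -ratio B θ ρ v := by
  have hden : denSq B θ ρ (reflect v) = denSq B θ ρ v := by
    simp only [denSq, reflect]
    ring
  rw [ratio, hden, ratio, ← neg_div]
  simp only [reflect]
  ring

lemma measureReal_ratio_lt_neg :
    (ratioBase B).real {v | ratio B θ ρ v < -q} = 1 - F B q θ ρ := by
  have hs : MeasurableSet {v | q < ratio B θ ρ v} := measurable_ratio B θ ρ measurableSet_Ioi
  rw [← measureReal_lt_ratio, measureReal_def, measureReal_def,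
    ← (measurePreserving_reflect B).measure_preimage hs.nullMeasurableSet]
  congr 2
  ext v
  simp only [Set.mem_preimage, Set.mem_ofPred_eq, ratio_reflect]
  exact lt_neg

lemma denSq_eq (v : ℝ × ℝ × ℝ × ℝ) :
    denSq B θ ρ v = (θ ^ 2 + ρ ^ 2) / B * v.2.2.2
      + (√((θ ^ 2 + ρ ^ 2) / B) * v.2.2.1 - v.2.1) ^ 2 := by
  have hsq : √((θ ^ 2 + ρ ^ 2) / B) ^ 2 = (θ ^ 2 + ρ ^ 2) / B := Real.sq_sqrt (by positivity)
  rw [denSq, sub_sq, mul_pow, hsq]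
  ring

lemma sq_le_denSq {v : ℝ × ℝ × ℝ × ℝ} (hv : 0 ≤ v.2.2.2) :
    (√((θ ^ 2 + ρ ^ 2) / B) * v.2.2.1 - v.2.1) ^ 2 ≤ denSq B θ ρ v := by
  rw [denSq_eq]
  exact le_add_of_nonneg_left (by positivity)

lemma ae_ratioBase_nonneg : ∀ᵐ v ∂(ratioBase B), 0 ≤ v.2.2.2 :=
  Measure.quasiMeasurePreserving_snd.ae <| Measure.quasiMeasurePreserving_snd.ae <|
    Measure.quasiMeasurePreserving_snd.ae <| ae_nonneg_chiSq (B - 1)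

lemma ae_prod_fst_ne {α β : Type*} [MeasurableSpace α] [MeasurableSpace β] [MeasurableEq α]
    {μ : Measure α} [SFinite μ] [NullSingletonClass μ] {ν : Measure β} [SFinite ν] {f : β → α}
    (hf : Measurable f) : ∀ᵐ z ∂(μ.prod ν), z.1 ≠ f z.2 := by
  have hm : MeasurableSet {z : α × β | z.1 = f z.2} :=
    measurableSet_eq_fun measurable_fst (hf.comp measurable_snd)
  rw [ae_iff]
  simp only [not_not]
  rw [Measure.prod_apply_symm hm]
  exact (lintegral_congr fun y => measure_singleton (f y)).trans lintegral_zero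

lemma ae_denSq_pos : ∀ᵐ v ∂(ratioBase B), 0 < denSq B θ ρ v := by
  have : NullSingletonClass (gaussianReal 0 1) := nullSingletonClass_gaussianReal one_ne_zero
  have hne : ∀ᵐ v ∂(ratioBase B), v.2.1 ≠ √((θ ^ 2 + ρ ^ 2) / B) * v.2.2.1 :=
    Measure.quasiMeasurePreserving_snd.ae <|
      ae_prod_fst_ne (f := fun y : ℝ × ℝ => √((θ ^ 2 + ρ ^ 2) / B) * y.1) (by fun_prop)
  filter_upwards [hne, ae_ratioBase_nonneg B] with v hv hv0
  exact (sq_pos_of_ne_zero (sub_ne_zero.2 hv.symm)).trans_le (sq_le_denSq B θ ρ hv0)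

variable {θ} in
lemma ae_num_ne (hθ : θ ≠ 0) :
    ∀ᵐ v ∂(ratioBase B), θ * v.1 + v.2.1 ≠ q * √(denSq B θ ρ v) := by
  have : NullSingletonClass (gaussianReal 0 1) := nullSingletonClass_gaussianReal one_ne_zero
  have hf : Measurable fun y : ℝ × ℝ × ℝ => (q * √(denSq B θ ρ (0, y)) - y.1) / θ := by
    have := (measurable_denSq B θ ρ).comp (measurable_prodMk_left (x := (0 : ℝ)))
    exact ((this.sqrt.const_mul q).sub measurable_fst).div_const θ
  filter_upwards [ae_prod_fst_ne hf] with v hv heq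
  exact hv ((eq_div_iff hθ).2 (eq_sub_of_add_eq ((add_left_inj _).2 (mul_comm _ _) |>.trans heq)))

variable {θ} in
lemma ae_abs_num_lt_or_lt_ratio_or_ratio_lt (hθ : θ ≠ 0) :
    ∀ᵐ v ∂(ratioBase B), |θ * v.1 + v.2.1| < q * √(denSq B θ ρ v) ∨
      q < ratio B θ ρ v ∨ ratio B θ ρ v < -q := by
  filter_upwards [ae_denSq_pos B θ ρ, ae_num_ne B ρ q hθ, ae_num_ne B ρ (-q) hθ]
    with v hden hne hne'
  have hsqrt : 0 < √(denSq B θ ρ v) := Real.sqrt_pos.2 hden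
  rw [ratio, lt_div_iff₀ hsqrt, div_lt_iff₀ hsqrt, abs_lt, ← neg_mul]
  grind

end Ratio

section CriticalValue

variable {B : ℕ} {ρ α q : ℝ}

lemma mem_criticalSet_iff :
    q ∈ criticalSet B ρ α ↔ ∀ θ : ℝ≥0, 1 - α / 2 ≤ F B q θ ρ := by
  have hbdd : BddBelow (Set.range fun θ : ℝ≥0 => F B q θ ρ) :=
    ⟨0, Set.forall_mem_range.2 fun θ => cdf_nonneg _ _⟩
  exact le_ciInf_iff hbdd

lemma measureReal_le_add_of_ae {Ω : Type*} [MeasurableSpace Ω] {μ : Measure Ω}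
    [IsFiniteMeasure μ] {s t u : Set Ω} (h : ∀ᵐ ω ∂μ, ω ∈ s → ω ∈ t ∨ ω ∈ u) :
    μ.real s ≤ μ.real t + μ.real u :=
  (ENNReal.toReal_mono (measure_ne_top _ _) (measure_mono_ae h)).trans (measureReal_union_le t u)

lemma le_ratioBase_abs_num_lt (hq : q ∈ criticalSet B ρ α) {θ : ℝ≥0} (hθ : θ ≠ 0) :
    1 - α ≤ (ratioBase B).real {v | |θ * v.1 + v.2.1| < q * √(denSq B θ ρ v)} := by
  have hcover := measureReal_le_add_of_ae (s := Set.univ)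
    (t := {v | |(θ : ℝ) * v.1 + v.2.1| < q * √(denSq B θ ρ v)})
    (u := {v | q < ratio B θ ρ v} ∪ {v | ratio B θ ρ v < -q}) <|
    (ae_abs_num_lt_or_lt_ratio_or_ratio_lt B ρ q (NNReal.coe_ne_zero.2 hθ)).mono fun v hv _ => hv
  have htails := measureReal_union_le (μ := ratioBase B)
    {v | q < ratio B θ ρ v} {v | ratio B θ ρ v < -q}
  rw [measureReal_lt_ratio, measureReal_ratio_lt_neg] at htails
  rw [probReal_univ] at hcover
  have hF := mem_criticalSet_iff.1 hq θ
  linarith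

lemma gaussianPDFReal_zero_one_le_one (x : ℝ) : gaussianPDFReal 0 1 x ≤ 1 := by
  have hsqrt : 1 ≤ √(2 * Real.pi * (1 : ℝ≥0)) := by
    rw [Real.one_le_sqrt, NNReal.coe_one, mul_one]
    linarith [Real.pi_gt_three]
  refine mul_le_one₀ (inv_le_one_of_one_le₀ hsqrt) (Real.exp_pos _).le (Real.exp_le_one_iff.2 ?_)
  exact div_nonpos_of_nonpos_of_nonneg (neg_nonpos.2 (sq_nonneg _)) (by positivity)

lemma gaussianReal_ball_le (m r : ℝ) :
    gaussianReal 0 1 (Metric.ball m r) ≤ ENNReal.ofReal (2 * r) := by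
  rw [gaussianReal_apply 0 one_ne_zero]
  calc ∫⁻ x in Metric.ball m r, gaussianPDF 0 1 x ≤ ∫⁻ _ in Metric.ball m r, 1 :=
        lintegral_mono fun x => ENNReal.ofReal_le_one.2 (gaussianPDFReal_zero_one_le_one x)
    _ = ENNReal.ofReal (2 * r) := by rw [setLIntegral_one, Real.volume_ball]

lemma measureReal_abs_sub_lt_le {f : ℝ → ℝ} (hf : Measurable f) {r : ℝ} (hr : 0 ≤ r) :
    (ratioBase B).real {v | |v.2.2.1 - f v.2.1| < r} ≤ 2 * r := by
  have hm : MeasurableSet {z : ℝ × ℝ × ℝ | |z.2.1 - f z.1| < r} :=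
    measurableSet_lt (by fun_prop) measurable_const
  have hslice (x : ℝ) : ((gaussianReal 0 1).prod (chiSq (B - 1)))
      (Prod.mk x ⁻¹' {z : ℝ × ℝ × ℝ | |z.2.1 - f z.1| < r}) ≤ ENNReal.ofReal (2 * r) := by
    refine le_of_eq_of_le ?_ (gaussianReal_ball_le (f x) r)
    rw [← (measurePreserving_fst (ν := chiSq (B - 1))).measure_preimage
      Metric.isOpen_ball.measurableSet.nullMeasurableSet]
    rfl
  refine ENNReal.toReal_le_of_le_ofReal (by positivity) ?_
  calc ratioBase B {v | |v.2.2.1 - f v.2.1| < r}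
      = ((gaussianReal 0 1).prod ((gaussianReal 0 1).prod (chiSq (B - 1))))
          {z | |z.2.1 - f z.1| < r} :=
        measurePreserving_snd.measure_preimage hm.nullMeasurableSet
    _ ≤ ∫⁻ _, ENNReal.ofReal (2 * r) ∂(gaussianReal 0 1) := by
        rw [Measure.prod_apply hm]
        exact lintegral_mono hslice
    _ = ENNReal.ofReal (2 * r) := by simp

lemma exists_measureReal_gt_le {Ω : Type*} [MeasurableSpace Ω] (μ : Measure Ω)
    [IsProbabilityMeasure μ] {f : Ω → ℝ} (hf : Measurable f) {ε : ℝ} (hε : 0 < ε) :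
    ∃ M : ℝ, μ.real {ω | M < f ω} ≤ ε := by
  have : IsProbabilityMeasure (μ.map f) := Measure.isProbabilityMeasure_map hf.aemeasurable
  obtain ⟨M, hM⟩ :=
    ((tendsto_cdf_atTop (μ.map f)).eventually_const_lt (sub_lt_self 1 hε)).exists
  refine ⟨M, ?_⟩
  rw [cdf_eq_real, map_measureReal_apply hf measurableSet_Iic] at hM
  have hcompl : {ω | M < f ω} = (f ⁻¹' Set.Iic M)ᶜ := by ext; simp
  rw [hcompl, probReal_compl_eq_one_sub (hf measurableSet_Iic)]
  linarith

lemma min_one_div_sqrt_mul_le_sqrt (hρ : 0 ≤ ρ) (θ : ℝ) :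
    min 1 ρ / √(2 * B) * (1 + θ) ≤ √((θ ^ 2 + ρ ^ 2) / B) := by
  have hmin : 0 ≤ min 1 ρ := le_min zero_le_one hρ
  have hmin_one : min 1 ρ ^ 2 ≤ 1 := pow_le_one₀ hmin (min_le_left _ _)
  have hmin_ρ : min 1 ρ ^ 2 ≤ ρ ^ 2 := pow_le_pow_left₀ hmin (min_le_right _ _) 2
  refine Real.le_sqrt_of_sq_le ?_
  calc (min 1 ρ / √(2 * B) * (1 + θ)) ^ 2 = min 1 ρ ^ 2 * ((1 + θ) ^ 2 / 2) / B := by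
        rw [mul_pow, div_pow, Real.sq_sqrt (by positivity)]
        ring
    _ ≤ min 1 ρ ^ 2 * (θ ^ 2 + 1) / B := by
        gcongr
        nlinarith [sq_nonneg (1 - θ)]
    _ ≤ (θ ^ 2 + ρ ^ 2) / B := by
        gcongr
        nlinarith [mul_le_mul_of_nonneg_right hmin_one (sq_nonneg θ)]

lemma ratio_le {c M δ θ : ℝ} (hθ : 0 ≤ θ) (hc : 0 < c) (hδ : 0 < δ)
    (hscale : c * (1 + θ) ≤ √((θ ^ 2 + ρ ^ 2) / B)) {v : ℝ × ℝ × ℝ × ℝ} (hv : 0 ≤ v.2.2.2)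
    (hM : |v.1| + |v.2.1| ≤ M) (hdist : δ ≤ |v.2.2.1 - v.2.1 / √((θ ^ 2 + ρ ^ 2) / B)|) :
    ratio B θ ρ v ≤ M / (c * δ) := by
  set a := √((θ ^ 2 + ρ ^ 2) / B)
  have ha0 : 0 < a := (by positivity : 0 < c * (1 + θ)).trans_le hscale
  have hnum : θ * v.1 + v.2.1 ≤ (1 + θ) * M := by
    nlinarith [le_abs_self v.1, le_abs_self v.2.1, abs_nonneg v.1, abs_nonneg v.2.1,
      mul_le_mul_of_nonneg_left (le_abs_self v.1) hθ, mul_nonneg hθ (abs_nonneg v.2.1),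
      mul_le_mul_of_nonneg_left hM hθ]
  have hden : (1 + θ) * (c * δ) ≤ √(denSq B θ ρ v) := calc
    (1 + θ) * (c * δ) = c * (1 + θ) * δ := by ring
    _ ≤ a * |v.2.2.1 - v.2.1 / a| := by gcongr
    _ = |a * v.2.2.1 - v.2.1| := by
        rw [← abs_of_pos ha0, ← abs_mul, abs_of_pos ha0, mul_sub, mul_div_cancel₀ _ ha0.ne']
    _ ≤ √(denSq B θ ρ v) := Real.abs_le_sqrt (sq_le_denSq B θ ρ hv)
  have hM0 : 0 ≤ M := (by positivity : 0 ≤ |v.1| + |v.2.1|).trans hM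
  calc ratio B θ ρ v ≤ (1 + θ) * M / ((1 + θ) * (c * δ)) :=
        div_le_div₀ (by positivity) hnum (by positivity) hden
    _ = M / (c * δ) := mul_div_mul_left _ _ (by positivity)

lemma criticalSet_nonempty (hB : B ≠ 0) (hρ : 0 < ρ) (hα : 0 < α) :
    (criticalSet B ρ α).Nonempty := by
  obtain ⟨M, hM⟩ := exists_measureReal_gt_le (ratioBase B)
    (f := fun v => |v.1| + |v.2.1|) (by fun_prop) (ε := α / 4) (by positivity)
  set c := min 1 ρ / √(2 * B)
  have hc : 0 < c := div_pos (lt_min one_pos hρ) (by positivity)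
  refine ⟨M / (c * (α / 8)), mem_criticalSet_iff.2 fun θ => ?_⟩
  have hscale : c * (1 + θ) ≤ √((θ ^ 2 + ρ ^ 2) / B) := min_one_div_sqrt_mul_le_sqrt hρ.le θ
  have htail := measureReal_le_add_of_ae (μ := ratioBase B)
    (s := {v | M / (c * (α / 8)) < ratio B θ ρ v}) (t := {v | M < |v.1| + |v.2.1|})
    (u := {v | |v.2.2.1 - v.2.1 / √((θ ^ 2 + ρ ^ 2) / B)| < α / 8}) <| by
      filter_upwards [ae_ratioBase_nonneg B] with v hv hlt
      by_contra! hcon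
      exact not_lt_of_ge (ratio_le θ.2 hc (by positivity) hscale hv hcon.1 hcon.2) hlt
  have hdist := measureReal_abs_sub_lt_le (B := B) (r := α / 8)
    (measurable_id.div_const √((θ ^ 2 + ρ ^ 2) / B)) (by positivity)
  rw [measureReal_lt_ratio] at htail
  simp only [id_eq] at hdist
  linarith

lemma bddBelow_criticalSet (hα : α < 2) : BddBelow (criticalSet B ρ α) := by
  obtain ⟨q₀, hq₀⟩ := ((tendsto_cdf_atBot (ratioLaw B (0 : ℝ≥0) ρ)).eventually_lt_const
    (by linarith : 0 < 1 - α / 2)).exists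
  refine ⟨q₀, fun q hq => ?_⟩
  by_contra! hlt
  exact (((mem_criticalSet_iff.1 hq 0).trans (monotone_cdf _ hlt.le)).trans_lt hq₀).false

lemma isLeast_criticalSet (hB : B ≠ 0) (hρ : 0 < ρ) (hα : 0 < α) (hα' : α < 2) :
    IsLeast (criticalSet B ρ α) (qO B ρ α) := by
  refine ⟨mem_criticalSet_iff.2 fun θ => ?_, fun q hq => csInf_le (bddBelow_criticalSet hα') hq⟩
  have hcont : Tendsto (fun q => F B q θ ρ) (𝓝[>] (qO B ρ α)) (𝓝 (F B (qO B ρ α) θ ρ)) :=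
    ((cdf (ratioLaw B θ ρ)).right_continuous _).mono_left
      (nhdsWithin_mono _ Set.Ioi_subset_Ici_self)
  refine ge_of_tendsto hcont ?_
  filter_upwards [self_mem_nhdsWithin] with q hq
  obtain ⟨q', hq', hlt⟩ := exists_lt_of_csInf_lt (criticalSet_nonempty hB hρ hα) hq
  exact (mem_criticalSet_iff.1 hq' θ).trans (monotone_cdf _ hlt.le)

end CriticalValue

section StdGaussian

lemma exists_orthonormalBasis_apply_zero_eq {E : Type*} [NormedAddCommGroup E]
    [InnerProductSpace ℝ E] [FiniteDimensional ℝ E] {m : ℕ} (hE : Module.finrank ℝ E = m + 1)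
    {e : E} (he : ‖e‖ = 1) : ∃ b : OrthonormalBasis (Fin (m + 1)) ℝ E, b 0 = e := by
  have horth : Orthonormal ℝ (({0} : Set (Fin (m + 1))).domRestrict fun _ => e) :=
    orthonormal_subsingleton_iff.2 fun _ => he
  obtain ⟨b, hb⟩ := horth.exists_orthonormalBasis_extension_of_card_eq (by simp [hE])
  exact ⟨b, hb 0 rfl⟩

lemma map_pi_apply_zero_sum_sq (m : ℕ) :
    (Measure.pi fun _ : Fin (m + 1) => gaussianReal 0 1).map (fun u => (u 0, ∑ i, u i ^ 2)) =
      ((gaussianReal 0 1).prod (chiSq m)).map fun z => (z.1, z.2 + z.1 ^ 2) := by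
  have hsplit := measurePreserving_piFinSuccAbove (fun _ : Fin (m + 1) => gaussianReal 0 1) 0
  have hcomp : (fun u : Fin (m + 1) → ℝ => (u 0, ∑ i, u i ^ 2)) =
      (fun z : ℝ × (Fin m → ℝ) => (z.1, (∑ i, z.2 i ^ 2) + z.1 ^ 2)) ∘
        MeasurableEquiv.piFinSuccAbove (fun _ => ℝ) 0 := by
    funext u
    simp [MeasurableEquiv.piFinSuccAbove, Fin.sum_univ_succ, add_comm, Fin.tail]
  have hchiSq : (gaussianReal 0 1).prod (chiSq m) =
      ((gaussianReal 0 1).prod (Measure.pi fun _ : Fin m => gaussianReal 0 1)).map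
        (Prod.map id fun z => ∑ i, z i ^ 2) := by
    rw [← Measure.map_prod_map _ _ measurable_id (by fun_prop), Measure.map_id, chiSq]
  rw [hcomp, ← Measure.map_map (by fun_prop) (MeasurableEquiv.measurable _), hsplit.map_eq,
    hchiSq, Measure.map_map (by fun_prop) (by fun_prop)]
  rfl

lemma stdGaussian_map_inner_norm_sq {E : Type*} [NormedAddCommGroup E] [InnerProductSpace ℝ E]
    [FiniteDimensional ℝ E] [MeasurableSpace E] [BorelSpace E] {m : ℕ}
    (hE : Module.finrank ℝ E = m + 1) {e : E} (he : ‖e‖ = 1) :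
    (stdGaussian E).map (fun v => (inner ℝ e v, ‖v‖ ^ 2)) =
      ((gaussianReal 0 1).prod (chiSq m)).map fun z => (z.1, z.2 + z.1 ^ 2) := by
  obtain ⟨b, rfl⟩ := exists_orthonormalBasis_apply_zero_eq hE he
  have hcoord : (fun v => (inner ℝ (b 0) v, ‖v‖ ^ 2)) =
      (fun w : EuclideanSpace ℝ (Fin (m + 1)) => (w 0, ‖w‖ ^ 2)) ∘ b.repr := by
    funext v
    simp only [Function.comp_apply, b.repr_apply_apply, b.repr.norm_map]
  rw [hcoord, ← Measure.map_map (by fun_prop) (by fun_prop), stdGaussian_map,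
    ← map_pi_eq_stdGaussian, Measure.map_map (by fun_prop) (by fun_prop),
    ← map_pi_apply_zero_sum_sq]
  simp only [Function.comp_def, EuclideanSpace.real_norm_sq_eq]

lemma map_pi_mean_sum_sq {B : ℕ} (hB : B ≠ 0) :
    (Measure.pi fun _ : Fin B => gaussianReal 0 1).map
        (fun u => ((∑ i, u i) / √B, ∑ i, u i ^ 2)) =
      ((gaussianReal 0 1).prod (chiSq (B - 1))).map fun z => (z.1, z.2 + z.1 ^ 2) := by
  obtain ⟨m, rfl⟩ : ∃ m, B = m + 1 := Nat.exists_eq_succ_of_ne_zero hB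
  let e : EuclideanSpace ℝ (Fin (m + 1)) := WithLp.toLp 2 fun _ => (√(m + 1 : ℕ))⁻¹
  have he : ‖e‖ = 1 := by
    rw [← sq_eq_sq₀ (norm_nonneg _) zero_le_one, EuclideanSpace.real_norm_sq_eq]
    simp only [e, Finset.sum_const, Finset.card_univ, Fintype.card_fin, nsmul_eq_mul, inv_pow,
      Real.sq_sqrt (Nat.cast_nonneg _), one_pow]
    exact mul_inv_cancel₀ (Nat.cast_ne_zero.2 m.succ_ne_zero)
  rw [m.add_sub_cancel, ← stdGaussian_map_inner_norm_sq finrank_euclideanSpace_fin he,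
    ← map_pi_eq_stdGaussian, Measure.map_map (by fun_prop) (by fun_prop)]
  congr 1
  funext u
  simp [e, EuclideanSpace.real_norm_sq_eq, PiLp.inner_apply, Finset.sum_mul, div_eq_mul_inv]

end StdGaussian

section Coverage

variable {B : ℕ} {q : ℝ}

/-- The error vectors, in the coordinates of `errVec`, for which the interval with critical value
`q` contains the target in its interior. -/
def coverSet (B : ℕ) (q : ℝ) : Set (ℝ × ℝ × (Fin B → ℝ)) :=
  {v | |v.1 + v.2.1| < q * √((∑ b, (v.2.2 b - v.2.1) ^ 2) / B)}

lemma isOpen_coverSet : IsOpen (coverSet B q) :=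
  isOpen_lt (by fun_prop) (by fun_prop)

lemma smul_mem_coverSet_iff {r : ℝ} (hr : 0 < r) {v : ℝ × ℝ × (Fin B → ℝ)} :
    r • v ∈ coverSet B q ↔ v ∈ coverSet B q := by
  have hsd : √((∑ b, (r * v.2.2 b - r * v.2.1) ^ 2) / B) =
      r * √((∑ b, (v.2.2 b - v.2.1) ^ 2) / B) := by
    simp only [← mul_sub, mul_pow]
    rw [← Finset.mul_sum, mul_div_assoc, Real.sqrt_mul (by positivity), Real.sqrt_sq hr.le]
  simp only [coverSet, Set.mem_ofPred_eq, Prod.smul_fst, Prod.smul_snd, Pi.smul_apply, smul_eq_mul,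
    hsd, ← mul_add, abs_mul, abs_of_pos hr]
  rw [mul_left_comm, mul_lt_mul_iff_right₀ hr]

lemma mem_intervalO_of_errVec_mem_coverSet {𝒳 𝒰 : Type*} [MeasurableSpace 𝒳]
    {ψ : ProbabilityMeasure 𝒳 → ℝ} {run : ProbabilityMeasure 𝒳 → 𝒰 → ℝ} {P : ProbabilityMeasure 𝒳}
    {n : ℕ+} {R₀ R : ℕ} {ω : Outcome 𝒳 𝒰 n B R₀ R} (h : errVec ψ run P ω ∈ coverSet B q) :
    ψ P ∈ intervalO run q ω := by
  have hn : 0 < √(n : ℝ) := Real.sqrt_pos.2 (Nat.cast_pos.2 n.pos)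
  replace h := (smul_mem_coverSet_iff (v := (ψ (empirical ω.1) - ψ P,
    pointEst run ω - ψ (empirical ω.1), fun b => resampleEst run ω b - ψ (empirical ω.1))) hn).1 h
  simp only [coverSet, Set.mem_ofPred_eq, sub_add_sub_cancel', sub_sub_sub_cancel_right] at h
  change |pointEst run ω - ψ P| < q * SO run ω at h
  obtain ⟨hlower, hupper⟩ := abs_le.1 h.le
  constructor <;> linarith

lemma scaledNormalLaw_mul_coverSet {r : ℝ} (hr : 0 < r) (c s k : ℝ) :
    scaledNormalLaw B (r * c) (r * s) (r * k) (coverSet B q) =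
      scaledNormalLaw B c s k (coverSet B q) := by
  rw [scaledNormalLaw, scaledNormalLaw, Measure.map_apply (by fun_prop)
    isOpen_coverSet.measurableSet, Measure.map_apply (by fun_prop) isOpen_coverSet.measurableSet]
  congr 1
  ext z
  refine .trans ?_ (smul_mem_coverSet_iff (v := (c * z.1, s * z.2.1, fun b => k * z.2.2 b)) hr)
  simp only [Set.mem_preimage, Prod.smul_mk, smul_eq_mul, mul_assoc, Pi.smul_def]

lemma sum_mul_sub_sq_div (hB : B ≠ 0) {a : ℝ} (ha : 0 ≤ a) (x : ℝ) (u : Fin B → ℝ) :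
    (∑ b, (√a * u b - x) ^ 2) / B =
      a / B * ∑ b, u b ^ 2 - 2 * √(a / B) * ((∑ b, u b) / √B) * x + x ^ 2 := by
  have hsum : ∑ b, (√a * u b - x) ^ 2 =
      a * ∑ b, u b ^ 2 - 2 * √a * x * ∑ b, u b + B * x ^ 2 := by
    simp only [sub_sq, mul_pow, Real.sq_sqrt ha, Finset.sum_add_distrib, Finset.sum_sub_distrib,
      Finset.mul_sum, Finset.sum_const, Finset.card_univ, Fintype.card_fin, nsmul_eq_mul]
    congr 2
    exact Finset.sum_congr rfl fun i _ => by ring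
  have hB' : (B : ℝ) = √B * √B := (Real.mul_self_sqrt (Nat.cast_nonneg B)).symm
  rw [hsum, Real.sqrt_div ha]
  have : √(B : ℝ) ≠ 0 := Real.sqrt_ne_zero'.2 (by positivity)
  field_simp
  grind

lemma map_prod_pi_mean_sum_sq (hB : B ≠ 0) :
    ((gaussianReal 0 1).prod ((gaussianReal 0 1).prod
        (Measure.pi fun _ : Fin B => gaussianReal 0 1))).map
        (Prod.map id (Prod.map id fun u => ((∑ i, u i) / √B, ∑ i, u i ^ 2))) =
      (ratioBase B).map (Prod.map id (Prod.map id fun z => (z.1, z.2 + z.1 ^ 2))) := by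
  have : IsProbabilityMeasure ((Measure.pi fun _ : Fin B => gaussianReal 0 1).map
    fun u => ((∑ i, u i) / √B, ∑ i, u i ^ 2)) := Measure.isProbabilityMeasure_map (by fun_prop)
  rw [ratioBase, ← Measure.map_prod_map _ _ measurable_id (by fun_prop),
    ← Measure.map_prod_map _ _ measurable_id (by fun_prop),
    ← Measure.map_prod_map _ _ measurable_id (by fun_prop),
    ← Measure.map_prod_map _ _ measurable_id (by fun_prop), map_pi_mean_sum_sq hB]

lemma scaledNormalLaw_coverSet (hB : B ≠ 0) (θ ρ : ℝ) :
    scaledNormalLaw B θ 1 √(θ ^ 2 + ρ ^ 2) (coverSet B q) =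
      ratioBase B {v | |θ * v.1 + v.2.1| < q * √(denSq B θ ρ v)} := by
  let T : Set (ℝ × ℝ × ℝ × ℝ) := {w | |θ * w.1 + w.2.1| < q * √((θ ^ 2 + ρ ^ 2) / B * w.2.2.2 -
    2 * √((θ ^ 2 + ρ ^ 2) / B) * w.2.2.1 * w.2.1 + w.2.1 ^ 2)}
  have hT : MeasurableSet T := measurableSet_lt (by fun_prop) (by fun_prop)
  have hevent := congrArg (· T) (map_prod_pi_mean_sum_sq hB)
  rw [Measure.map_apply (by fun_prop) hT, Measure.map_apply (by fun_prop) hT] at hevent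
  rw [scaledNormalLaw, Measure.map_apply (by fun_prop) isOpen_coverSet.measurableSet]
  refine .trans (congrArg _ ?_) hevent
  ext z
  change |θ * z.1 + 1 * z.2.1| <
    q * √((∑ b, (√(θ ^ 2 + ρ ^ 2) * z.2.2 b - 1 * z.2.1) ^ 2) / B) ↔ _
  rw [one_mul, sum_mul_sub_sq_div hB (by positivity)]
  rfl

lemma le_scaledNormalLaw_coverSet (hB : B ≠ 0) {α c s ρ : ℝ} (hc : 0 < c) (hs : 0 < s)
    (hq : q ∈ criticalSet B ρ α) :
    ENNReal.ofReal (1 - α) ≤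
      scaledNormalLaw B c s √(c ^ 2 + ρ ^ 2 * s ^ 2) (coverSet B q) := by
  obtain ⟨θ, hθ, rfl⟩ : ∃ θ : ℝ≥0, θ ≠ 0 ∧ c = s * θ :=
    ⟨⟨c / s, by positivity⟩, NNReal.coe_ne_zero.1 (div_pos hc hs).ne',
      (mul_div_cancel₀ c hs.ne').symm⟩
  have hk : √((s * θ) ^ 2 + ρ ^ 2 * s ^ 2) = s * √((θ : ℝ) ^ 2 + ρ ^ 2) := by
    rw [mul_pow, mul_comm (ρ ^ 2), ← mul_add, Real.sqrt_mul (by positivity), Real.sqrt_sq hs.le]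
  have hscale := scaledNormalLaw_mul_coverSet (B := B) (q := q) hs θ 1 √((θ : ℝ) ^ 2 + ρ ^ 2)
  rw [mul_one] at hscale
  rw [hk, hscale, scaledNormalLaw_coverSet hB]
  exact ENNReal.ofReal_le_of_le_toReal (le_ratioBase_abs_num_lt hq hθ)

end Coverage

end CheapBootstrap

open CheapBootstrap in
theorem theorem4_general {𝒳 𝒰 : Type*} [MeasurableSpace 𝒳] [MeasurableSpace 𝒰]
    (P : ProbabilityMeasure 𝒳) (ψ : ProbabilityMeasure 𝒳 → ℝ)
    (run : ProbabilityMeasure 𝒳 → 𝒰 → ℝ) (η : Measure 𝒰) [IsProbabilityMeasure η]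
    (hmeas : ∀ n : ℕ+, Measurable fun z : (Fin n → 𝒳) × 𝒰 => run (empirical z.1) z.2)
    (hunbiased : ∀ Q, Integrable (run Q) η ∧ ∫ u, run Q u ∂η = ψ Q)
    (σ : ℝ≥0) (hboot : BootstrapValidity ψ P σ) (hmom : MomentConsistency ψ run η P)
    (R₀ R : ℕ+ → ℕ) (p₀ p : ℝ) (hp₀ : 0 < p₀) (hp : 0 < p)
    (hR₀ : Tendsto (fun n : ℕ+ => (R₀ n : ℝ) / n) atTop (𝓝 p₀))
    (hR : Tendsto (fun n : ℕ+ => (R n : ℝ) / n) atTop (𝓝 p))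
    (B : ℕ) (hB : 1 ≤ B) (α : ℝ) (hα : 0 < α) (hα' : α < 2) :
    IsLeast (criticalSet B (√(p₀ / p)) α) (qO B (√(p₀ / p)) α) ∧
    ENNReal.ofReal (1 - α) ≤ liminf (fun n : ℕ+ =>
      outcomeLaw P η n B (R₀ n) (R n)
        {ω | ψ P ∈ intervalO run (qO B (√(p₀ / p)) α) ω}) atTop := by
  have hB₀ : B ≠ 0 := Nat.one_le_iff_ne_zero.1 hB
  have hleast := isLeast_criticalSet hB₀ (Real.sqrt_pos.2 (div_pos hp₀ hp)) hα hα'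
  refine ⟨hleast, ?_⟩
  have hvar : 0 < (runVar run η P).toReal := ENNReal.toReal_pos hmom.var_pos.ne' hmom.var_lt_top.ne
  have hcover := le_scaledNormalLaw_coverSet hB₀ (NNReal.coe_pos.2 hboot.pos)
    (Real.sqrt_pos.2 (div_pos hvar hp₀)) hleast.1
  have hscale : √(p₀ / p) ^ 2 * √((runVar run η P).toReal / p₀) ^ 2 =
      (runVar run η P).toReal / p := by
    rw [Real.sq_sqrt (by positivity), Real.sq_sqrt (by positivity)]
    field_simp
  rw [hscale] at hcover
  have hlimit := ProbabilityMeasure.le_liminf_measure_open_of_tendsto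
    (tendsto_law_errVec hmeas hunbiased hboot hmom hp₀ hp hR₀ hR)
    (isOpen_coverSet (B := B) (q := qO B √(p₀ / p) α))
  refine hcover.trans (hlimit.trans (liminf_le_liminf (.of_forall fun n => ?_)))
  have herr : Measurable fun ω : Outcome 𝒳 𝒰 n B (R₀ n) (R n) => errVec ψ run P ω :=
    measurable_errVec (hmeas n) fun x => (hunbiased (empirical x)).2
  exact (Measure.map_apply herr isOpen_coverSet.measurableSet).trans_le
    (measure_mono fun ω => mem_intervalO_of_errVec_mem_coverSet)

open CheapBootstrap in
theorem theorem4 {𝒳 𝒰 : Type*} [MeasurableSpace 𝒳] [MeasurableSpace 𝒰]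
    (P : ProbabilityMeasure 𝒳) (ψ : ProbabilityMeasure 𝒳 → ℝ)
    (run : ProbabilityMeasure 𝒳 → 𝒰 → ℝ) (η : Measure 𝒰) [IsProbabilityMeasure η]
    (hmeas : ∀ n : ℕ+, Measurable fun z : (Fin n → 𝒳) × 𝒰 => run (empirical z.1) z.2)
    (hunbiased : ∀ Q, Integrable (run Q) η ∧ ∫ u, run Q u ∂η = ψ Q)
    (σ : ℝ≥0) (hboot : BootstrapValidity ψ P σ) (hmom : MomentConsistency ψ run η P)
    (R₀ R : ℕ+ → ℕ) (p₀ p : ℝ) (hp₀ : 0 < p₀) (hp₀' : p₀ < 1) (hp : 0 < p) (hp' : p < 1)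
    (hR₀ : Tendsto (fun n : ℕ+ => (R₀ n : ℝ) / n) atTop (𝓝 p₀))
    (hR : Tendsto (fun n : ℕ+ => (R n : ℝ) / n) atTop (𝓝 p))
    (B : ℕ) (hB : 1 ≤ B) (α : ℝ) (hα : 0 < α) (hα' : α < 1) :
    IsLeast (criticalSet B (√(p₀ / p)) α) (qO B (√(p₀ / p)) α) ∧
    ENNReal.ofReal (1 - α) ≤ liminf (fun n : ℕ+ =>
      outcomeLaw P η n B (R₀ n) (R n)
        {ω | ψ P ∈ intervalO run (qO B (√(p₀ / p)) α) ω}) atTop :=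
  theorem4_general P ψ run η hmeas hunbiased σ hboot hmom R₀ R p₀ p hp₀ hp hR₀ hR B hB α hα
    (hα'.trans one_lt_two)
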